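/- For $f\in L^\infty(\mathbb R^d)$ let $\mathscr F f$ be the (distributional) Fourier transform, $(\mathscr F f)(t)=\int_{\mathbb R^d} f(x)e^{-i(x,t)}\,dx$. For $\sigma>0$ let $$(\mathscr E^\infty_\sigma)_+(\mathbb R^2)=\{f\in L^\infty(\mathbb R^2):\ \operatorname{supp}\mathscr F f\subset\{t\in[0,\infty)^2:\ |t|\le\sigma\}\},$$ where $|t|$ is the Euclidean norm, and let $$C_{A,\infty}(\mathbb R^2)=\{f\in C(\mathbb R^2)\cap L^\infty(\mathbb R^2):\ \operatorname{supp}\mathscr F f\subset[0,\infty)^2\}.$$ The Haagerup tensor product $C_{A,\infty}(\mathbb R^2)\otimes_{\rm h}C_{A,\infty}(\mathbb R^2)$ consists of the functions $\Phi$ on $\mathbb R^2\times\mathbb R^2$ that admit a pointwise convergent expansion $\Phi(p,q)=\sum_{n}\varphi_n(p)\psi_n(q)$ with $\varphi_n,\psi_n\in C_{A,\infty}(\mathbb R^2)$ and $\sup_p\sum_n|\varphi_n(p)|^2<\infty$, $\sup_q\sum_n|\psi_n(q)|^2<\infty$; the norm $\|\Phi\|_{C_{A,\infty}(\mathbb R^2)\otimes_{\rm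 h}C_{A,\infty}(\mathbb R^2)}$ is the infimum of $\big(\sup_p\sum_n|\varphi_n(p)|^2\big)^{1/2}\big(\sup_q\sum_n|\psi_n(q)|^2\big)^{1/2}$ over all such expansions. Theorem. Let $\sigma>0$ and $f\in(\mathscr E^\infty_\sigma)_+(\mathbb R^2)$. Then $f$ coincides almost everywhere with an infinitely differentiable function, again denoted by $f$. Put $$(D_xf)(x_1,y_1;x_2,y_2)=\frac{f(x_1,y_2)-f(x_2,y_2)}{x_1-x_2},\qquad (D_yf)(x_1,y_1;x_2,y_2)=\frac{f(x_1,y_1)-f(x_1,y_2)}{y_1-y_2},$$ where the quotients are understood as $\frac{\partial f}{\partial x}(x_2,y_2)$ if $x_1=x_2$ and as $\frac{\partial f}{\partial y}(x_1,y_2)$ if $y_1=y_2$. Then $D_xf$ and $D_yf$ belong to $C_{A,\infty}(\mathbb R^2)\otimes_{\rm h}C_{A,\infty}(\mathbb R^2)$, and $$\|D_xf\|_{C_{A,\infty}(\mathbb R^2)\otimes_{\rm h}C_{A,\infty}(\mathbb R^2)}\le\frac{2}{\sqrt\pi}\,\sigma\|f\|_{L^\infty(\mathbb R^2)},\qquad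 \|D_yf\|_{C_{A,\infty}(\mathbb R^2)\otimes_{\rm h}C_{A,\infty}(\mathbb R^2)}\le\frac{2}{\sqrt\pi}\,\sigma\|f\|_{L^\infty(\mathbb R^2)}.$$ -/

import Mathlib

open MeasureTheory
open scoped ENNReal FourierTransform SchwartzMap

noncomputable section

/-- The support of the Fourier transform `∫ f(x) e^{-i(x,t)} dx` (a tempered distribution in the
angular frequency `t`) of a function `f ∈ L^∞(ℝ^d)`. Mathlib's `𝓕` is `∫ f(x) e^{-2πi(x,ξ)} dx`,
so that `t = 2πξ`. -/
def fourierSupport {d : ℕ} (f : Lp ℂ ∞ (volume : Measure (EuclideanSpace ℝ (Fin d)))) :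
    Set (EuclideanSpace ℝ (Fin d)) :=
  {t | (2 * Real.pi)⁻¹ • t ∈
    Distribution.dsupport
      (𝓕 (f : 𝓢'(EuclideanSpace ℝ (Fin d), ℂ)) : 𝓢'(EuclideanSpace ℝ (Fin d), ℂ))}

/-- The closed orthant `[0, ∞)^d`. -/
def nonnegOrthant (d : ℕ) : Set (EuclideanSpace ℝ (Fin d)) :=
  {t | ∀ i, 0 ≤ t i}

/-- The space `(𝓔^∞_σ)_+(ℝ^d)`: functions in `L^∞(ℝ^d)` whose Fourier transform is supported in
the intersection of the closed Euclidean ball of radius `σ` with `[0, ∞)^d`. -/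
def expTypePlus (d : ℕ) (σ : ℝ) : Set (Lp ℂ ∞ (volume : Measure (EuclideanSpace ℝ (Fin d)))) :=
  {f | fourierSupport f ⊆ Metric.closedBall 0 σ ∩ nonnegOrthant d}

/-- The space `C_{A,∞}(ℝ^d)`: bounded continuous functions whose Fourier transform is supported
in `[0, ∞)^d`. -/
def contAnalytic (d : ℕ) : Set (EuclideanSpace ℝ (Fin d) → ℂ) :=
  {g | Continuous g ∧ ∃ hg : MemLp g ∞ volume, fourierSupport (hg.toLp g) ⊆ nonnegOrthant d}

/-- `‖∑ₙ |φₙ|²‖` in the supremum norm. For continuous `φₙ` on `ℝ^d` this is the `L^∞` norm of the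
sum, because the sum is lower semicontinuous. -/
def rowNorm {X : Type*} (φ : ℕ → X → ℂ) : ℝ≥0∞ :=
  ⨆ x, ∑' n, ‖φ n x‖ₑ ^ 2

/-- `Φ(x, y) = ∑ₙ φₙ(x) ψₙ(y)` with `φₙ ∈ A`, `ψₙ ∈ B`, and `∑ₙ |φₙ|²`, `∑ₙ |ψₙ|²` bounded. -/
structure IsHaagerupExpansion {X Y : Type*} (A : Set (X → ℂ)) (B : Set (Y → ℂ))
    (Φ : X → Y → ℂ) (φ : ℕ → X → ℂ) (ψ : ℕ → Y → ℂ) : Prop where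
  left_mem : ∀ n, φ n ∈ A
  right_mem : ∀ n, ψ n ∈ B
  left_bounded : rowNorm φ < ∞
  right_bounded : rowNorm ψ < ∞
  hasSum : ∀ x y, HasSum (fun n => φ n x * ψ n y) (Φ x y)

/-- The Haagerup tensor product `A ⊗_h B` of two spaces of functions, as a set of functions of
two variables. -/
def haagerupTensor {X Y : Type*} (A : Set (X → ℂ)) (B : Set (Y → ℂ)) : Set (X → Y → ℂ) :=
  {Φ | ∃ φ ψ, IsHaagerupExpansion A B Φ φ ψ}

/-- The norm of `A ⊗_h B`: the infimum of `‖∑ₙ |φₙ|²‖^{1/2} ‖∑ₙ |ψₙ|²‖^{1/2}` over all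
expansions. It is `∞` when there is no expansion. -/
def haagerupNorm {X Y : Type*} (A : Set (X → ℂ)) (B : Set (Y → ℂ)) (Φ : X → Y → ℂ) : ℝ≥0∞ :=
  ⨅ (φ : ℕ → X → ℂ) (ψ : ℕ → Y → ℂ) (_ : IsHaagerupExpansion A B Φ φ ψ),
    rowNorm φ ^ (1 / 2 : ℝ) * rowNorm ψ ^ (1 / 2 : ℝ)

/-- `(D_x f)(x₁, y₁; x₂, y₂) = (f(x₁, y₂) - f(x₂, y₂)) / (x₁ - x₂)`, with the value
`∂f/∂x (x₂, y₂)` when `x₁ = x₂`. -/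
def divDiffX (f : EuclideanSpace ℝ (Fin 2) → ℂ) (p q : EuclideanSpace ℝ (Fin 2)) : ℂ :=
  dslope (fun s : ℝ => f !₂[s, q 1]) (q 0) (p 0)

/-- `(D_y f)(x₁, y₁; x₂, y₂) = (f(x₁, y₁) - f(x₁, y₂)) / (y₁ - y₂)`, with the value
`∂f/∂y (x₁, y₂)` when `y₁ = y₂`. -/
def divDiffY (f : EuclideanSpace ℝ (Fin 2) → ℂ) (p q : EuclideanSpace ℝ (Fin 2)) : ℂ :=
  dslope (fun t : ℝ => f !₂[p 0, t]) (q 1) (p 1)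

end

/-!
One of the two factors of the expansions does not depend on `f`. For a function `u` on the line,
of modulus at most `M` and with frequencies in `[0, σ]`, the divided difference
`y ↦ g(y) = (u(y) - u(x))/(y - x)`
has its frequencies in `[0, σ]` and is square integrable. It is therefore the sum of its cardinal
series over the nodes `2πn/σ`: `g(x') = ∑ₙ g(2πn/σ) cₙ(x')`, where `cₙ` is the mean of
`e^{iv(x' - 2πn/σ)}` over `v ∈ [0, σ]` (`hasSum_bandInt`). By Parseval's identity
`∑ₙ |cₙ(x')|² = 1`, and `∑ₙ |g(2πn/σ)|² = (σ/2π) ∫ |g|²`. The last identity is obtained from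
the fact that the sum over the nodes `2πn/σ + s` does not depend on `s` (`hasSum_norm_sq_bandInt`),
by averaging over `s`. Bernstein's inequality `|g| ≤ σM` (`norm_dslope_freqInt_le`) and the trivial
bound `|g(y)| ≤ 2M/|y - x|` are used for `|y - x| ≤ 2/σ` and `|y - x| > 2/σ` respectively, and give
`∫ |g|² ≤ 8σM²`, so that the square sum is at most `4σ²M²/π = (2σM/√π)²`
(`hasCardinalDivDiff_freqInt`).

This is applied to the restrictions of `f` to the lines parallel to one of the axes. The rows
`cₙ` and `q ↦ g(2πn/σ)`, where `g` is formed at `x = qᵢ` on the line through `q`, also have to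
be continuous functions with spectrum in the orthant. If `f` is a superposition
`∫ k(ω) e^{i(q, Ξ(ω))} dμ(ω)` of plane waves with frequencies in `[0, σ]^d`, this is read off from
the divided difference of an exponential, which is a superposition of exponentials with the
frequencies between `0` and the given one (`coordDivDiff_waveInt`).

The general case is a limit of this one. For a smooth probability density `β` on the unit cube the
function `θ = 𝓕⁻ β` has `θ(0) = 1` and `|θ| ≤ 1`, and the product `f(x) θ(εx)` is integrable with
Fourier transform supported in a cube of side `σ/2π + ε`, hence is a superposition of plane waves
almost everywhere (`fourier_mul_fourierInv_smul_eq_zero`, `ae_eq_fourierInv_fourier`). Since `θ`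
does not vanish near the origin, `f` is almost everywhere equal to a smooth function
(`exists_smooth_representative`). After a dilation, which brings the spectrum back into the cube of
side `σ/2π`, the products converge to `f` as `ε → 0` together with all divided differences.
Bounded pointwise convergence preserves spectra in the orthant (`HasOrthantSpectrum.of_tendsto`),
and the expansions pass to the limit by dominated convergence (`HasCardinalDivDiff.of_tendsto`).
-/

noncomputable section

/-! ### Parseval and the sampling series on a frequency band -/

open Complex in
/-- Parseval's identity for the inner product of two square integrable functions on `(a, b]`. -/
theorem hasSum_conj_fourierCoeffOn_mul {a b : ℝ} {f g : ℝ → ℂ} (hab : a < b)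
    (hf : MemLp f 2 (volume.restrict (Set.Ioc a b)))
    (hg : MemLp g 2 (volume.restrict (Set.Ioc a b))) :
    HasSum (fun n => (starRingEnd ℂ) (fourierCoeffOn hab f n) * fourierCoeffOn hab g n)
      ((b - a)⁻¹ • ∫ x in a..b, (starRingEnd ℂ) (f x) * g x) := by
  have := Fact.mk (by linarith : 0 < b - a)
  rw [← add_sub_cancel a b] at hf hg
  have hf' := hf.memLp_liftIoc.haarAddCircle
  have hg' := hg.memLp_liftIoc.haarAddCircle
  convert! fourierBasis.hasSum_inner_mul_inner hf'.toLp hg'.toLp using 1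
  · ext n
    rw [← fourierBasis.repr_apply_apply, fourierBasis_repr, ← inner_conj_symm,
      ← fourierBasis.repr_apply_apply, fourierBasis_repr, fourierCoeff_congr_ae hf'.coeFn_toLp,
      fourierCoeff_congr_ae hg'.coeFn_toLp]
    simp [fourierCoeff_liftIoc_eq]
  · rw [L2.inner_def]
    nth_rw 2 [← add_sub_cancel a b]
    rw [← AddCircle.integral_liftIoc_eq_intervalIntegral, ← AddCircle.integral_haarAddCircle]
    apply integral_congr_ae
    filter_upwards [hf'.coeFn_toLp, hg'.coeFn_toLp] with x hx hx'
    rw [hx, hx']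
    simp [AddCircle.liftIoc, mul_comm]

/-- The sampling node `2πn/σ` of the frequency band `[0, σ]`. -/
def sampleNode (σ : ℝ) (n : ℤ) : ℝ := 2 * Real.pi * n / σ

/-- The `n`-th cardinal function of the frequency band `[0, σ]`, as the mean over the band of the
exponentials `e^{iv(x - 2πn/σ)}`. -/
def cardinalFun (σ : ℝ) (n : ℤ) (x : ℝ) : ℂ :=
  σ⁻¹ • ∫ v in (0 : ℝ)..σ, Complex.exp (v * (x - sampleNode σ n) * Complex.I)

/-- The function `x ↦ ∫₀^σ e^{ivx} H(v) dv` with frequency density `H` on `[0, σ]`. -/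
def bandInt (σ : ℝ) (H : ℝ → ℂ) (x : ℝ) : ℂ :=
  ∫ v in (0 : ℝ)..σ, Complex.exp (v * x * Complex.I) * H v

lemma fourierCoeffOn_zero_eq {σ : ℝ} (hσ : 0 < σ) (f : ℝ → ℂ) (n : ℤ) :
    fourierCoeffOn hσ f n =
      σ⁻¹ • ∫ v in (0 : ℝ)..σ, Complex.exp (-(v * sampleNode σ n) * Complex.I) * f v := by
  rw [fourierCoeffOn_eq_integral]
  simp only [sub_zero, one_div]
  congr 1
  apply intervalIntegral.integral_congr
  intro v _
  simp only [smul_eq_mul]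
  rw [fourier_coe_apply]
  congr 2
  simp only [sampleNode]
  push_cast
  ring

lemma cardinalFun_eq_fourierCoeffOn {σ : ℝ} (hσ : 0 < σ) (n : ℤ) (x : ℝ) :
    cardinalFun σ n x = fourierCoeffOn hσ (fun v => Complex.exp (v * x * Complex.I)) n := by
  rw [fourierCoeffOn_zero_eq, cardinalFun]
  congr 1
  apply intervalIntegral.integral_congr
  intro v _
  simp only []
  rw [← Complex.exp_add]
  congr 1
  ring

lemma norm_exp_ofReal_mul_ofReal_mul_I (v x : ℝ) :
    ‖Complex.exp (v * x * Complex.I)‖ = 1 := by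
  rw [← Complex.ofReal_mul, Complex.norm_exp_ofReal_mul_I]

lemma memLp_two_exp (σ x : ℝ) :
    MemLp (fun v : ℝ => Complex.exp (v * x * Complex.I)) 2 (volume.restrict (Set.Ioc 0 σ)) := by
  refine MemLp.of_bound (by fun_prop) 1 (Filter.Eventually.of_forall fun v => ?_)
  rw [norm_exp_ofReal_mul_ofReal_mul_I]

lemma hasSum_norm_sq_cardinalFun {σ : ℝ} (hσ : 0 < σ) (x : ℝ) :
    HasSum (fun n => ‖cardinalFun σ n x‖ ^ 2) 1 := by
  have h := hasSum_sq_fourierCoeffOn hσ (memLp_two_exp σ x)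
  simp only [norm_exp_ofReal_mul_ofReal_mul_I] at h
  simpa [cardinalFun_eq_fourierCoeffOn hσ, hσ.ne'] using h

lemma bandInt_sampleNode {σ : ℝ} (hσ : 0 < σ) (H : ℝ → ℂ) (s : ℝ) (n : ℤ) :
    bandInt σ H (s + sampleNode σ n) =
      σ * fourierCoeffOn hσ (fun v => Complex.exp (v * s * Complex.I) * H v) (-n) := by
  rw [fourierCoeffOn_zero_eq, Complex.real_smul, Complex.ofReal_inv,
    mul_inv_cancel_left₀ (by exact_mod_cast hσ.ne'), bandInt]
  apply intervalIntegral.integral_congr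
  intro v _
  simp only []
  rw [← mul_assoc, ← Complex.exp_add]
  congr 2
  simp only [sampleNode]
  push_cast
  ring

/-- Parseval's identity for the samples of a band-limited function: their sum of squares is the
same for all shifts of the sampling nodes. -/
lemma hasSum_norm_sq_bandInt {σ : ℝ} (hσ : 0 < σ) {H : ℝ → ℂ}
    (hH : MemLp H 2 (volume.restrict (Set.Ioc 0 σ))) (s : ℝ) :
    HasSum (fun n => ‖bandInt σ H (s + sampleNode σ n)‖ ^ 2)
      (σ * ∫ v in (0 : ℝ)..σ, ‖H v‖ ^ 2) := by
  have hm : MemLp (fun v : ℝ => Complex.exp (v * s * Complex.I) * H v) 2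
      (volume.restrict (Set.Ioc 0 σ)) := by
    refine hH.of_le (AEStronglyMeasurable.mul (by fun_prop) hH.1)
      (Filter.Eventually.of_forall fun v => ?_)
    rw [norm_mul, norm_exp_ofReal_mul_ofReal_mul_I, one_mul]
  have h := (hasSum_sq_fourierCoeffOn hσ hm).mul_left (σ ^ 2)
  rw [← (Equiv.neg ℤ).hasSum_iff] at h
  convert! h using 1
  · ext n
    rw [bandInt_sampleNode hσ, norm_mul, mul_pow]
    simp [abs_of_pos hσ]
  · simp only [norm_mul, norm_exp_ofReal_mul_ofReal_mul_I, one_mul, sub_zero, smul_eq_mul]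
    field_simp

/-- The sampling (cardinal) series of a band-limited function. -/
lemma hasSum_bandInt {σ : ℝ} (hσ : 0 < σ) {H : ℝ → ℂ}
    (hH : MemLp H 2 (volume.restrict (Set.Ioc 0 σ))) (x : ℝ) :
    HasSum (fun n => bandInt σ H (sampleNode σ n) * cardinalFun σ n x) (bandInt σ H x) := by
  have h := (hasSum_conj_fourierCoeffOn_mul hσ hH.star (memLp_two_exp σ x)).mul_left (σ : ℂ)
  convert! h using 1
  · ext n
    rw [← cardinalFun_eq_fourierCoeffOn hσ, ← mul_assoc]
    congr 1
    have := bandInt_sampleNode hσ H 0 n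
    rw [zero_add] at this
    rw [this]
    congr 1
    simp only [fourierCoeffOn_zero_eq, Complex.real_smul, map_mul, Complex.conj_ofReal]
    congr 1
    rw [← intervalIntegral.intervalIntegral_conj]
    apply intervalIntegral.integral_congr
    intro v _
    simp only [sampleNode, Int.cast_neg, ← Complex.exp_conj, Pi.star_apply, map_mul, map_neg,
      Complex.conj_ofReal, Complex.conj_I, RCLike.star_def, Complex.conj_conj]
    congr 2
    push_cast
    ring_nf
    simp
  · rw [sub_zero, Complex.real_smul, Complex.ofReal_inv,
      mul_inv_cancel_left₀ (by exact_mod_cast hσ.ne'), bandInt]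
    apply intervalIntegral.integral_congr
    intro v _
    simp [mul_comm]

/-! ### The divided difference of a superposition of exponentials -/

/-- The function `x ↦ ∫ h(ω) e^{ixξ(ω)} dμ(ω)`: a superposition of exponentials with frequencies
`ξ(ω)` and amplitudes `h(ω)`. -/
def freqInt {Ω : Type*} [MeasurableSpace Ω] (μ : Measure Ω) (h : Ω → ℂ) (ξ : Ω → ℝ) (x : ℝ) : ℂ :=
  ∫ ω, h ω * Complex.exp (x * ξ ω * Complex.I) ∂μ

/-- The integrand, in `ω` and the frequency `v ∈ [0, ξ(ω)]`, of the divided difference of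
`x ↦ e^{ixξ(ω)}` at `x`, without the factor `e^{ivx'}`. -/
def divDiffDensity {Ω : Type*} (h : Ω → ℂ) (ξ : Ω → ℝ) (x : ℝ) (ω : Ω) (v : ℝ) : ℂ :=
  h ω * Complex.I * (if v < ξ ω then Complex.exp ((ξ ω - v) * x * Complex.I) else 0)

section
variable {Ω : Type*} [MeasurableSpace Ω] {μ : Measure Ω} {h : Ω → ℂ} {ξ : Ω → ℝ} {σ : ℝ}

lemma norm_divDiffDensity_le {Ω : Type*} (h : Ω → ℂ) (ξ : Ω → ℝ) (x : ℝ) (ω : Ω) (v : ℝ) :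
    ‖divDiffDensity h ξ x ω v‖ ≤ ‖h ω‖ := by
  rw [divDiffDensity, norm_mul, norm_mul, Complex.norm_I, mul_one]
  refine mul_le_of_le_one_right (norm_nonneg _) ?_
  split_ifs
  · rw [← Complex.ofReal_sub, norm_exp_ofReal_mul_ofReal_mul_I]
  · simp

lemma aestronglyMeasurable_divDiffDensity [SFinite μ] (hh : Integrable h μ) (hξ : Measurable ξ)
    (x : ℝ) (ν : Measure ℝ) [SFinite ν] :
    AEStronglyMeasurable (fun p : Ω × ℝ => divDiffDensity h ξ x p.1 p.2) (μ.prod ν) := by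
  unfold divDiffDensity
  refine (hh.1.comp_fst.mul_const _).mul (Measurable.aestronglyMeasurable ?_)
  refine Measurable.ite (measurableSet_lt measurable_snd (hξ.comp measurable_fst)) ?_
    measurable_const
  fun_prop

lemma integrable_divDiffDensity [SFinite μ] (hh : Integrable h μ) (hξ : Measurable ξ)
    (x : ℝ) (ν : Measure ℝ) [IsFiniteMeasure ν] :
    Integrable (fun p : Ω × ℝ => divDiffDensity h ξ x p.1 p.2) (μ.prod ν) :=
  (hh.comp_fst ν).mono (aestronglyMeasurable_divDiffDensity hh hξ x ν)
    (Filter.Eventually.of_forall fun _ => norm_divDiffDensity_le ..)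

lemma memLp_two_integral_divDiffDensity [SFinite μ] (hh : Integrable h μ) (hξ : Measurable ξ)
    (x : ℝ) : MemLp (fun v => ∫ ω, divDiffDensity h ξ x ω v ∂μ) 2
      (volume.restrict (Set.Ioc 0 σ)) := by
  refine MemLp.of_bound (C := ∫ ω, ‖h ω‖ ∂μ) ?_ (Filter.Eventually.of_forall fun v => ?_)
  · exact (aestronglyMeasurable_divDiffDensity hh hξ x
      (volume.restrict (Set.Ioc 0 σ))).prod_swap.integral_prod_right'
  · exact norm_integral_le_of_norm_le hh.norm
      (Filter.Eventually.of_forall fun ω => norm_divDiffDensity_le h ξ x ω v)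

lemma integral_exp_mul_exp (x x' ξ : ℝ) :
    (x' - x) * ∫ v in (0 : ℝ)..ξ, Complex.exp (v * x' * Complex.I) *
      (Complex.I * Complex.exp ((ξ - v) * x * Complex.I)) =
    Complex.exp (x' * ξ * Complex.I) - Complex.exp (x * ξ * Complex.I) := by
  rw [← intervalIntegral.integral_const_mul]
  have hd : ∀ v : ℝ, HasDerivAt
      (fun v : ℝ => Complex.exp (v * x' * Complex.I + (ξ - v) * x * Complex.I))
      ((x' - x) * (Complex.exp (v * x' * Complex.I) *
      (Complex.I * Complex.exp ((ξ - v) * x * Complex.I)))) v := by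
    intro v
    have hv : HasDerivAt (fun v : ℝ => (v : ℂ)) 1 v := Complex.ofRealCLM.hasDerivAt
    have := (((hv.mul_const (x' : ℂ)).mul_const Complex.I).add
      (((hv.const_sub (ξ : ℂ)).mul_const (x : ℂ)).mul_const Complex.I)).cexp
    convert! this using 1
    simp only [Pi.add_apply, Complex.exp_add]
    ring
  rw [intervalIntegral.integral_eq_sub_of_hasDerivAt (fun v _ => hd v)
    (Continuous.intervalIntegrable (by fun_prop) _ _)]
  simp only [Complex.ofReal_zero, zero_mul, sub_zero, sub_self, add_zero, zero_add]
  ring_nf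

/-- For a frequency in `[0, σ]`, the density is that of the divided difference of the
exponential. -/
lemma sub_mul_integral_divDiffDensity {Ω : Type*} {h : Ω → ℂ} {ξ : Ω → ℝ} {σ : ℝ} {ω : Ω}
    (hs : h ω ≠ 0 → ξ ω ∈ Set.Icc 0 σ) (x x' : ℝ) :
    (x' - x) * ∫ v in (0 : ℝ)..σ, Complex.exp (v * x' * Complex.I) * divDiffDensity h ξ x ω v =
    h ω * (Complex.exp (x' * ξ ω * Complex.I) - Complex.exp (x * ξ ω * Complex.I)) := by
  by_cases h0 : h ω = 0
  · simp [divDiffDensity, h0]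
  obtain ⟨h1, h2⟩ := hs h0
  rw [← integral_exp_mul_exp, mul_left_comm]
  congr 1
  rw [← intervalIntegral.integral_const_mul, intervalIntegral.integral_of_le (h1.trans h2),
    intervalIntegral.integral_of_le h1, integral_Ioc_eq_integral_Ioo,
    integral_Ioc_eq_integral_Ioo, ← integral_indicator measurableSet_Ioo,
    ← integral_indicator measurableSet_Ioo]
  congr 1
  ext v
  simp only [Set.indicator_apply, divDiffDensity, Set.mem_Ioo]
  split_ifs with h3 h4 h5 h6 h7
  · ring
  · exact absurd ⟨h3.1, h4⟩ h5
  · exact absurd h6.2 h4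
  · simp
  · exact absurd ⟨h7.1, h7.2.trans_le h2⟩ h3
  · rfl

lemma bandInt_divDiffDensity_eq_integral [SFinite μ] (hσ : 0 ≤ σ) (hh : Integrable h μ)
    (hξ : Measurable ξ) (x x' : ℝ) :
    bandInt σ (fun v => ∫ ω, divDiffDensity h ξ x ω v ∂μ) x' =
      ∫ ω, (∫ v in (0 : ℝ)..σ,
        Complex.exp (v * x' * Complex.I) * divDiffDensity h ξ x ω v) ∂μ := by
  simp only [bandInt, intervalIntegral.integral_of_le hσ, ← integral_const_mul]
  rw [← integral_integral_swap]
  refine (integrable_divDiffDensity hh hξ x (volume.restrict (Set.Ioc 0 σ))).mono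
    (AEStronglyMeasurable.mul (f := fun p : Ω × ℝ => Complex.exp (p.2 * x' * Complex.I))
      (by fun_prop) (aestronglyMeasurable_divDiffDensity hh hξ x _))
      (Filter.Eventually.of_forall fun p => ?_)
  simp only [Function.uncurry]
  rw [norm_mul, norm_exp_ofReal_mul_ofReal_mul_I, one_mul]

lemma integrable_mul_exp (hh : Integrable h μ) (hξ : Measurable ξ) (x : ℝ) :
    Integrable (fun ω => h ω * Complex.exp (x * ξ ω * Complex.I)) μ := by
  refine hh.mono (hh.1.mul (by fun_prop)) (Filter.Eventually.of_forall fun ω => ?_)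
  rw [norm_mul, norm_exp_ofReal_mul_ofReal_mul_I, mul_one]

lemma sub_mul_bandInt_divDiffDensity [SFinite μ] (hσ : 0 ≤ σ) (hh : Integrable h μ)
    (hξ : Measurable ξ) (hs : ∀ ω, h ω ≠ 0 → ξ ω ∈ Set.Icc 0 σ) (x x' : ℝ) :
    (x' - x) * bandInt σ (fun v => ∫ ω, divDiffDensity h ξ x ω v ∂μ) x' =
      freqInt μ h ξ x' - freqInt μ h ξ x := by
  rw [bandInt_divDiffDensity_eq_integral hσ hh hξ, ← integral_const_mul]
  simp_rw [fun ω => sub_mul_integral_divDiffDensity (hs ω) x x', mul_sub]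
  rw [integral_sub (integrable_mul_exp hh hξ x') (integrable_mul_exp hh hξ x)]
  rfl

lemma continuous_bandInt {H : ℝ → ℂ} (hH : MemLp H 2 (volume.restrict (Set.Ioc 0 σ)))
    (hσ : 0 ≤ σ) : Continuous (bandInt σ H) := by
  unfold bandInt
  simp only [intervalIntegral.integral_of_le hσ]
  refine continuous_of_dominated (bound := fun v => ‖H v‖) (fun x => ?_) (fun x => ?_) ?_ ?_
  · exact AEStronglyMeasurable.mul (by fun_prop) hH.1
  · refine Filter.Eventually.of_forall fun v => ?_
    rw [norm_mul, norm_exp_ofReal_mul_ofReal_mul_I, one_mul]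
  · exact (hH.integrable (by norm_num)).norm
  · exact Filter.Eventually.of_forall fun v => by fun_prop

/-- The divided difference of a function with frequencies in `[0, σ]`, as a function of one of its
variables, again has its frequencies in `[0, σ]`, with a bounded density. -/
theorem dslope_freqInt [SFinite μ] (hσ : 0 ≤ σ) (hh : Integrable h μ)
    (hξ : Measurable ξ) (hs : ∀ ω, h ω ≠ 0 → ξ ω ∈ Set.Icc 0 σ) (x x' : ℝ) :
    dslope (freqInt μ h ξ) x x' = bandInt σ (fun v => ∫ ω, divDiffDensity h ξ x ω v ∂μ) x' := by
  set P := bandInt σ (fun v => ∫ ω, divDiffDensity h ξ x ω v ∂μ)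
  have hne : ∀ y, y ≠ x → slope (freqInt μ h ξ) x y = P y := by
    intro y hy
    rw [slope_def_module, ← sub_mul_bandInt_divDiffDensity hσ hh hξ hs x y, Complex.real_smul,
      ← Complex.ofReal_sub, ← mul_assoc, ← Complex.ofReal_mul, inv_mul_cancel₀ (sub_ne_zero.2 hy)]
    simp [P]
  have hc : Continuous P := continuous_bandInt (memLp_two_integral_divDiffDensity hh hξ x) hσ
  by_cases hx : x' = x
  · subst hx
    rw [dslope_same]
    refine HasDerivAt.deriv (hasDerivAt_iff_tendsto_slope.2 ?_)
    refine (hc.tendsto x' |>.mono_left nhdsWithin_le_nhds).congr' ?_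
    filter_upwards [self_mem_nhdsWithin] with y hy using (hne y hy).symm
  · rw [dslope_of_ne _ hx, hne x' hx]

end

/-! ### The Bernstein inequality -/

/-- The Fourier series of the triangle wave. -/
lemma hasSum_cos_odd_div_sq {x : ℝ} (h0 : 0 ≤ x) (h1 : x ≤ 1 / 2) :
    HasSum (fun n : ℕ => 1 / (2 * n + 1 : ℝ) ^ 2 * Real.cos (2 * Real.pi * (2 * n + 1) * x))
      (Real.pi ^ 2 * (1 / 8 - x / 2)) := by
  have key : ∀ y : ℝ, 0 ≤ y → y ≤ 1 →
      HasSum (fun n : ℕ => 1 / (n : ℝ) ^ 2 * Real.cos (2 * Real.pi * n * y))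
        (Real.pi ^ 2 * (y ^ 2 - y + 1 / 6)) := by
    intro y hy hy'
    convert! hasSum_one_div_nat_pow_mul_cos one_ne_zero ⟨hy, hy'⟩ using 1
    have := bernoulliFun_two y
    rw [bernoulliFun] at this
    rw [mul_one, this, Nat.factorial_two]
    push_cast
    ring
  have hall := key x h0 (by linarith)
  have heven : HasSum (fun n : ℕ => 1 / ((2 * n : ℕ) : ℝ) ^ 2 *
      Real.cos (2 * Real.pi * (2 * n : ℕ) * x))
      (1 / 4 * (Real.pi ^ 2 * ((2 * x) ^ 2 - 2 * x + 1 / 6))) := by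
    convert! (key (2 * x) (by linarith) (by linarith)).mul_left (1 / 4) using 1
    ext n
    push_cast
    rw [show 2 * Real.pi * (2 * n) * x = 2 * Real.pi * n * (2 * x) by ring]
    rcases Nat.eq_zero_or_pos n with rfl | hn
    · simp
    · field_simp
      ring_nf
  have hodd : Summable (fun n : ℕ => 1 / ((2 * n + 1 : ℕ) : ℝ) ^ 2 *
      Real.cos (2 * Real.pi * (2 * n + 1 : ℕ) * x)) :=
    hall.summable.comp_injective (i := fun n : ℕ => 2 * n + 1) (fun a b h => by simpa using h)
  have := (HasSum.even_add_odd (f := fun n : ℕ => 1 / (n : ℝ) ^ 2 *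
    Real.cos (2 * Real.pi * n * x)) heven hodd.hasSum).unique hall
  convert! hodd.hasSum using 1
  · ext n
    push_cast
    rfl
  · linear_combination -this

section
variable {Ω : Type*} [MeasurableSpace Ω] {μ : Measure Ω} {h : Ω → ℂ} {ξ : Ω → ℝ} {σ M : ℝ}

lemma hasDerivAt_freqInt (hh : Integrable h μ) (hξ : Measurable ξ)
    (hs : ∀ ω, h ω ≠ 0 → ξ ω ∈ Set.Icc 0 σ) (x : ℝ) :
    HasDerivAt (freqInt μ h ξ)
      (∫ ω, h ω * Complex.exp (x * ξ ω * Complex.I) * (ξ ω * Complex.I) ∂μ) x := by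
  unfold freqInt
  refine (hasDerivAt_integral_of_dominated_loc_of_deriv_le (bound := fun ω => ‖h ω‖ * σ)
    (F' := fun x ω => h ω * Complex.exp (x * ξ ω * Complex.I) * (ξ ω * Complex.I))
    Filter.univ_mem (Filter.Eventually.of_forall fun x => (integrable_mul_exp hh hξ x).1)
    (integrable_mul_exp hh hξ x) ((integrable_mul_exp hh hξ x).1.mul (by fun_prop))
    (Filter.Eventually.of_forall fun ω y _ => ?_) (hh.norm.mul_const σ)
    (Filter.Eventually.of_forall fun ω y _ => ?_)).2
  · by_cases h0 : h ω = 0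
    · simp [h0]
    · rw [norm_mul, norm_mul, norm_exp_ofReal_mul_ofReal_mul_I, norm_mul, Complex.norm_I,
        mul_one, mul_one, Complex.norm_real, Real.norm_of_nonneg (hs ω h0).1]
      exact mul_le_mul_of_nonneg_left (hs ω h0).2 (norm_nonneg _)
  · have hv : HasDerivAt (fun v : ℝ => (v : ℂ)) 1 y := Complex.ofRealCLM.hasDerivAt
    have := (((hv.mul_const (ξ ω : ℂ)).mul_const Complex.I).cexp).const_mul (h ω)
    convert! this using 1
    ring

/-- The means of `u = freqInt μ h ξ` over the shifts by `±π(2n+1)/σ`, with the Fourier coefficients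
of the triangle wave of period `2σ` as weights, add up to the multiplier `π²(1/8 - ξ/4σ)`. -/
lemma hasSum_freqInt_shifts (hσ : 0 < σ) (hh : Integrable h μ) (hξ : Measurable ξ)
    (hs : ∀ ω, h ω ≠ 0 → ξ ω ∈ Set.Icc 0 σ) (x : ℝ) :
    HasSum (fun n : ℕ => ((1 / (2 * n + 1 : ℝ) ^ 2 : ℝ) : ℂ) *
        ((freqInt μ h ξ (x + Real.pi * (2 * n + 1) / σ) +
          freqInt μ h ξ (x - Real.pi * (2 * n + 1) / σ)) / 2))
      (∫ ω, h ω * Complex.exp (x * ξ ω * Complex.I) *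
        ((Real.pi ^ 2 * (1 / 8 - ξ ω / (2 * σ) / 2) : ℝ) : ℂ) ∂μ) := by
  have hsum0 := (hasSum_cos_odd_div_sq le_rfl (by norm_num : (0 : ℝ) ≤ 1 / 2)).summable
  simp only [mul_zero, Real.cos_zero, mul_one] at hsum0
  have hterm : ∀ n : ℕ, ((1 / (2 * n + 1 : ℝ) ^ 2 : ℝ) : ℂ) *
        ((freqInt μ h ξ (x + Real.pi * (2 * n + 1) / σ) +
          freqInt μ h ξ (x - Real.pi * (2 * n + 1) / σ)) / 2) =
      ∫ ω, h ω * Complex.exp (x * ξ ω * Complex.I) *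
        ((1 / (2 * n + 1 : ℝ) ^ 2 *
          Real.cos (2 * Real.pi * (2 * n + 1) * (ξ ω / (2 * σ))) : ℝ) : ℂ) ∂μ := by
    intro n
    unfold freqInt
    rw [← integral_add (integrable_mul_exp hh hξ _) (integrable_mul_exp hh hξ _),
      ← integral_div, ← integral_const_mul]
    congr 1
    ext ω
    have hσ' : (σ : ℂ) ≠ 0 := by exact_mod_cast hσ.ne'
    have e1 : (((x + Real.pi * (2 * n + 1) / σ : ℝ) : ℂ)) * ξ ω * Complex.I =
        x * ξ ω * Complex.I +
          ((2 * Real.pi * (2 * n + 1) * (ξ ω / (2 * σ)) : ℝ) : ℂ) * Complex.I := by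
      push_cast
      field_simp
    have e2 : (((x - Real.pi * (2 * n + 1) / σ : ℝ) : ℂ)) * ξ ω * Complex.I =
        x * ξ ω * Complex.I +
          -((2 * Real.pi * (2 * n + 1) * (ξ ω / (2 * σ)) : ℝ) : ℂ) * Complex.I := by
      push_cast
      field_simp
      ring
    rw [e1, e2, Complex.exp_add, Complex.exp_add, Complex.ofReal_mul _ (Real.cos _),
      Complex.ofReal_cos, Complex.cos]
    ring
  simp_rw [hterm]
  refine hasSum_integral_of_dominated_convergence
    (fun n ω => ‖h ω‖ * (1 / (2 * n + 1 : ℝ) ^ 2)) (fun n => ?_) (fun n => ?_) ?_ ?_ ?_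
  · exact (integrable_mul_exp hh hξ x).1.mul (by fun_prop)
  · refine Filter.Eventually.of_forall fun ω => ?_
    rw [norm_mul, norm_mul, norm_exp_ofReal_mul_ofReal_mul_I, mul_one, Complex.norm_real, norm_mul,
      Real.norm_of_nonneg (by positivity : (0 : ℝ) ≤ 1 / (2 * n + 1 : ℝ) ^ 2)]
    refine mul_le_mul_of_nonneg_left ?_ (norm_nonneg _)
    exact mul_le_of_le_one_right (by positivity) (Real.abs_cos_le_one _)
  · exact Filter.Eventually.of_forall fun ω => hsum0.mul_left _
  · simp_rw [tsum_mul_left]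
    exact hh.norm.mul_const _
  · refine Filter.Eventually.of_forall fun ω => ?_
    by_cases h0 : h ω = 0
    · simp [h0]
    · refine HasSum.mul_left _ (Complex.hasSum_ofReal.2 (hasSum_cos_odd_div_sq ?_ ?_))
      · exact div_nonneg (hs ω h0).1 (by positivity)
      · rw [div_le_iff₀ (by positivity)]
        linarith [(hs ω h0).2]

/-- Bernstein's inequality for a band of length `σ` on one side of the origin. It follows from an
interpolation formula of M. Riesz type, that is, from the Fourier series of the triangle wave
of period `2σ`, which is affine in the frequency on `[0, σ]`. -/
theorem norm_deriv_freqInt_le (hσ : 0 < σ) (hh : Integrable h μ) (hξ : Measurable ξ)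
    (hs : ∀ ω, h ω ≠ 0 → ξ ω ∈ Set.Icc 0 σ) (hM : ∀ x, ‖freqInt μ h ξ x‖ ≤ M) (x : ℝ) :
    ‖deriv (freqInt μ h ξ) x‖ ≤ σ * M := by
  have hS := hasSum_freqInt_shifts hσ hh hξ hs x
  set S := ∫ ω, h ω * Complex.exp (x * ξ ω * Complex.I) *
        ((Real.pi ^ 2 * (1 / 8 - ξ ω / (2 * σ) / 2) : ℝ) : ℂ) ∂μ with hSdef
  have hπ : (Real.pi : ℂ) ≠ 0 := by exact_mod_cast Real.pi_ne_zero
  have hσ' : (σ : ℂ) ≠ 0 := by exact_mod_cast hσ.ne'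
  have hSn : ‖S‖ ≤ Real.pi ^ 2 / 8 * M := by
    have h0 := (hasSum_cos_odd_div_sq le_rfl (by norm_num : (0 : ℝ) ≤ 1 / 2)).mul_right M
    simp only [mul_zero, Real.cos_zero, mul_one] at h0
    refine (hS.norm_le_of_bounded h0 fun n => ?_).trans (by ring_nf; rfl)
    rw [norm_mul, Complex.norm_real,
      Real.norm_of_nonneg (by positivity : (0 : ℝ) ≤ 1 / (2 * n + 1 : ℝ) ^ 2)]
    refine mul_le_mul_of_nonneg_left ?_ (by positivity)
    rw [norm_div, Complex.norm_ofNat, div_le_iff₀ two_pos]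
    exact (norm_add_le _ _).trans (by rw [mul_two]; exact add_le_add (hM _) (hM _))
  have hd : deriv (freqInt μ h ξ) x =
      Complex.I * (σ / 2 * freqInt μ h ξ x - 4 * σ / Real.pi ^ 2 * S) := by
    rw [(hasDerivAt_freqInt hh hξ hs x).deriv, hSdef, freqInt, ← integral_const_mul,
      ← integral_const_mul, ← integral_sub, ← integral_const_mul]
    · congr 1
      ext ω
      push_cast
      field_simp
      ring
    · exact (integrable_mul_exp hh hξ x).const_mul _
    · refine Integrable.const_mul ?_ _
      refine Integrable.mono' (hh.norm.mul_const (Real.pi ^ 2))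
        ((integrable_mul_exp hh hξ x).1.mul (by fun_prop)) (Filter.Eventually.of_forall fun ω => ?_)
      rw [norm_mul, norm_mul, norm_exp_ofReal_mul_ofReal_mul_I, mul_one]
      by_cases h0 : h ω = 0
      · simp [h0]
      refine mul_le_mul_of_nonneg_left ?_ (norm_nonneg _)
      rw [Complex.norm_real, norm_mul, Real.norm_of_nonneg (by positivity : 0 ≤ Real.pi ^ 2)]
      refine mul_le_of_le_one_right (by positivity) ?_
      obtain ⟨h1, h2⟩ := hs ω h0
      have h3 : 0 ≤ ξ ω / (2 * σ) := by positivity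
      have h4 : ξ ω / (2 * σ) ≤ 1 / 2 := by
        rw [div_le_iff₀ (by positivity)]
        linarith
      rw [Real.norm_eq_abs, abs_le]
      constructor <;> linarith
  rw [hd, norm_mul, Complex.norm_I, one_mul]
  refine (norm_sub_le _ _).trans ?_
  have e1 : ‖(σ / 2 * freqInt μ h ξ x : ℂ)‖ ≤ σ / 2 * M := by
    rw [norm_mul, norm_div, Complex.norm_real, Complex.norm_ofNat, Real.norm_of_nonneg hσ.le]
    exact mul_le_mul_of_nonneg_left (hM x) (by positivity)
  have e2 : ‖(4 * σ / Real.pi ^ 2 * S : ℂ)‖ ≤ 4 * σ / Real.pi ^ 2 * (Real.pi ^ 2 / 8 * M) := by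
    rw [norm_mul, norm_div, norm_mul, norm_pow, Complex.norm_real, Complex.norm_real,
      Complex.norm_ofNat, Real.norm_of_nonneg hσ.le, Real.norm_of_nonneg Real.pi_pos.le]
    exact mul_le_mul_of_nonneg_left hSn (by positivity)
  refine (add_le_add e1 e2).trans (le_of_eq ?_)
  field_simp
  ring

/-- The divided differences of a function of modulus at most `M`, with frequencies in `[0, σ]`, are
bounded by `σM`. -/
lemma norm_dslope_freqInt_le (hσ : 0 < σ) (hh : Integrable h μ) (hξ : Measurable ξ)
    (hs : ∀ ω, h ω ≠ 0 → ξ ω ∈ Set.Icc 0 σ) (hM : ∀ x, ‖freqInt μ h ξ x‖ ≤ M) (x x' : ℝ) :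
    ‖dslope (freqInt μ h ξ) x x'‖ ≤ σ * M := by
  by_cases hx : x' = x
  · rw [hx, dslope_same]
    exact norm_deriv_freqInt_le hσ hh hξ hs hM x
  · rw [dslope_of_ne _ hx, slope_def_module, norm_smul, norm_inv, inv_mul_le_iff₀
      (norm_pos_iff.2 (sub_ne_zero.2 hx)), mul_comm]
    exact Convex.norm_image_sub_le_of_norm_deriv_le
      (fun y _ => (hasDerivAt_freqInt hh hξ hs y).differentiableAt)
      (fun y _ => norm_deriv_freqInt_le hσ hh hξ hs hM y) convex_univ (Set.mem_univ _)
      (Set.mem_univ _)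
end

/-- The trivial bound on a divided difference of a bounded function. -/
lemma norm_dslope_mul_abs_le {u : ℝ → ℂ} {M : ℝ} (hM : ∀ x, ‖u x‖ ≤ M) (x x' : ℝ) :
    ‖dslope u x x'‖ * |x' - x| ≤ 2 * M := by
  have h0 : 0 ≤ M := (norm_nonneg _).trans (hM 0)
  by_cases hx : x' = x
  · simp [hx, h0]
  · rw [dslope_of_ne _ hx, slope_def_module, norm_smul, norm_inv, mul_comm, Real.norm_eq_abs,
      mul_inv_cancel_left₀ (abs_ne_zero.2 (sub_ne_zero.2 hx)), two_mul]
    exact (norm_sub_le _ _).trans (add_le_add (hM _) (hM _))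

/-! ### Square sums of the samples of a divided difference -/

/-- An integral over the line is the integral over one period of the sum over the shifts. -/
lemma lintegral_eq_setLIntegral_tsum {T : ℝ} (hT : 0 < T) {f : ℝ → ℝ≥0∞} (hf : Measurable f) :
    ∫⁻ y, f y = ∫⁻ s in Set.Ioc 0 T, ∑' n : ℤ, f (s + n * T) := by
  rw [lintegral_tsum (fun n => by fun_prop), ← setLIntegral_univ, ← iUnion_Ioc_add_zsmul hT 0,
    lintegral_iUnion (fun n => measurableSet_Ioc) (Set.pairwise_disjoint_Ioc_add_zsmul 0 T)]
  refine tsum_congr fun n => ?_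
  rw [← lintegral_indicator measurableSet_Ioc, ← lintegral_indicator measurableSet_Ioc,
    ← lintegral_add_right_eq_self _ ((n : ℝ) * T)]
  refine lintegral_congr fun y => ?_
  have : y + n * T ∈ Set.Ioc (0 + n • T) (0 + (n + 1) • T) ↔ y ∈ Set.Ioc 0 T := by
    simp only [zsmul_eq_mul, Set.mem_Ioc, Int.cast_add, Int.cast_one]
    constructor <;> rintro ⟨h1, h2⟩ <;> constructor <;> linarith
  by_cases hy : y ∈ Set.Ioc 0 T
  · rw [Set.indicator_of_mem hy, Set.indicator_of_mem (this.2 hy)]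
  · rw [Set.indicator_of_notMem hy, Set.indicator_of_notMem (mt this.1 hy)]

/-- The integral over a half-line of a function bounded by `σ²M²` and by `4M²/y²`. -/
lemma setLIntegral_Ioi_min_le {σ M : ℝ} (hσ : 0 < σ) {g : ℝ → ℝ≥0∞}
    (h1 : ∀ y, 0 < y → g y ≤ ENNReal.ofReal ((σ * M) ^ 2))
    (h2 : ∀ y, 0 < y → g y ≤ ENNReal.ofReal ((2 * M) ^ 2 * y ^ (-2 : ℝ))) :
    ∫⁻ y in Set.Ioi 0, g y ≤ ENNReal.ofReal (4 * σ * M ^ 2) := by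
  -- The two bounds coincide at `y = 2/σ`.
  have hc : 0 < 2 / σ := by positivity
  rw [← Set.Ioc_union_Ioi_eq_Ioi hc.le, lintegral_union measurableSet_Ioi
    (Set.Ioc_disjoint_Ioi_same)]
  have e1 : ∫⁻ y in Set.Ioc 0 (2 / σ), g y ≤ ENNReal.ofReal (2 * σ * M ^ 2) := by
    refine (setLIntegral_mono' measurableSet_Ioc fun y hy => h1 y hy.1).trans ?_
    rw [setLIntegral_const, Real.volume_Ioc, ← ENNReal.ofReal_mul (by positivity)]
    refine ENNReal.ofReal_le_ofReal (le_of_eq ?_)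
    field_simp
    ring
  have e2 : ∫⁻ y in Set.Ioi (2 / σ), g y ≤ ENNReal.ofReal (2 * σ * M ^ 2) := by
    refine (setLIntegral_mono' measurableSet_Ioi fun y hy => h2 y (hc.trans hy)).trans ?_
    rw [← ofReal_integral_eq_lintegral_ofReal]
    · rw [integral_const_mul, integral_Ioi_rpow_of_lt (by norm_num) hc]
      refine ENNReal.ofReal_le_ofReal (le_of_eq ?_)
      norm_num [Real.rpow_neg_one]
      field_simp
    · exact (integrableOn_Ioi_rpow_of_lt (by norm_num) hc).const_mul _
    · refine (ae_restrict_iff' measurableSet_Ioi).2 (Filter.Eventually.of_forall fun y hy => ?_)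
      have : 0 < y := hc.trans hy
      simp only [Pi.zero_apply]
      positivity
  refine (add_le_add e1 e2).trans (le_of_eq ?_)
  rw [← ENNReal.ofReal_add (by positivity) (by positivity)]
  congr 1
  ring

/-- The square integral of a function bounded by `σM` and by `2M/|y - x|`. -/
lemma lintegral_enorm_sq_le {σ M : ℝ} (hσ : 0 < σ) (x : ℝ) {g : ℝ → ℂ}
    (h1 : ∀ y, ‖g y‖ ≤ σ * M) (h2 : ∀ y, ‖g y‖ * |y - x| ≤ 2 * M) :
    ∫⁻ y, ‖g y‖ₑ ^ 2 ≤ ENNReal.ofReal (8 * σ * M ^ 2) := by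
  have hM1 : ∀ y, ‖g y‖ₑ ^ 2 ≤ ENNReal.ofReal ((σ * M) ^ 2) := fun y => by
    rw [← ofReal_norm, ← ENNReal.ofReal_pow (norm_nonneg _)]
    exact ENNReal.ofReal_le_ofReal (pow_le_pow_left₀ (norm_nonneg _) (h1 y) 2)
  have hM2 : ∀ y t, |y - x| = t → 0 < t →
      ‖g y‖ₑ ^ 2 ≤ ENNReal.ofReal ((2 * M) ^ 2 * t ^ (-2 : ℝ)) := fun y t hy ht => by
    rw [← ofReal_norm, ← ENNReal.ofReal_pow (norm_nonneg _)]
    refine ENNReal.ofReal_le_ofReal ?_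
    have h3 := pow_le_pow_left₀ (by positivity) (h2 y) 2
    rw [hy, mul_pow] at h3
    rw [Real.rpow_neg ht.le, Real.rpow_ofNat, ← div_eq_mul_inv, le_div_iff₀ (by positivity)]
    exact h3
  rw [← lintegral_add_right_eq_self _ x, ← setLIntegral_univ, ← Set.Iic_union_Ioi (a := (0 : ℝ)),
    lintegral_union measurableSet_Ioi (Set.Iic_disjoint_Ioi le_rfl)]
  have e1 : ∫⁻ y in Set.Ioi 0, ‖g (y + x)‖ₑ ^ 2 ≤ ENNReal.ofReal (4 * σ * M ^ 2) :=
    setLIntegral_Ioi_min_le hσ (fun y _ => hM1 _) fun y hy =>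
      hM2 _ _ (by rw [add_sub_cancel_right, abs_of_pos hy]) hy
  have e2 : ∫⁻ y in Set.Iic 0, ‖g (y + x)‖ₑ ^ 2 ≤ ENNReal.ofReal (4 * σ * M ^ 2) := by
    rw [setLIntegral_congr Iio_ae_eq_Iic.symm]
    have : ∫⁻ y in Set.Iio 0, ‖g (y + x)‖ₑ ^ 2 = ∫⁻ y in Set.Ioi 0, ‖g (-y + x)‖ₑ ^ 2 := by
      have := (Measure.measurePreserving_neg (volume : Measure ℝ)).setLIntegral_comp_preimage_emb
        (MeasurableEquiv.neg ℝ).measurableEmbedding (fun y => ‖g (y + x)‖ₑ ^ 2) (Set.Iio 0)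
      rw [← this]
      simp
    rw [this]
    exact setLIntegral_Ioi_min_le hσ (fun y _ => hM1 _) fun y hy =>
      hM2 _ _ (by rw [add_sub_cancel_right, abs_neg, abs_of_pos hy]) hy
  refine (add_le_add e2 e1).trans (le_of_eq ?_)
  rw [← ENNReal.ofReal_add (by positivity) (by positivity)]
  congr 1
  ring

/-- The divided differences of `u` are bounded like those of a function of modulus at most `M` with
frequencies in `[0, σ]`, and are the sums of their cardinal series. -/
structure HasCardinalDivDiff (σ M : ℝ) (u : ℝ → ℂ) : Prop where
  norm_le : ∀ x, ‖u x‖ ≤ M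
  norm_dslope_le : ∀ x x', ‖dslope u x x'‖ ≤ σ * M
  sum_sq_le : ∀ x (s : Finset ℤ),
    ∑ n ∈ s, ‖dslope u x (sampleNode σ n)‖ ^ 2 ≤ 4 * σ ^ 2 * M ^ 2 / Real.pi
  hasSum : ∀ x x', HasSum (fun n => dslope u x (sampleNode σ n) * cardinalFun σ n x')
    (dslope u x x')

/-- A bounded superposition of exponentials with frequencies in `[0, σ]` has the property.
The sum of the squares of the samples does not change when the nodes are shifted, so that it is
the average over the shifts, that is, `σ/2π` times the square integral of the divided difference.
-/
theorem hasCardinalDivDiff_freqInt {Ω : Type*} [MeasurableSpace Ω] {μ : Measure Ω} [SFinite μ]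
    {h : Ω → ℂ} {ξ : Ω → ℝ} {σ M : ℝ} (hσ : 0 < σ) (hh : Integrable h μ) (hξ : Measurable ξ)
    (hs : ∀ ω, h ω ≠ 0 → ξ ω ∈ Set.Icc 0 σ) (hM : ∀ x, ‖freqInt μ h ξ x‖ ≤ M) :
    HasCardinalDivDiff σ M (freqInt μ h ξ) := by
  refine ⟨hM, norm_dslope_freqInt_le hσ hh hξ hs hM, fun x s => ?_, fun x x' => ?_⟩
  · set H : ℝ → ℂ := fun v => ∫ ω, divDiffDensity h ξ x ω v ∂μ
    have hH : MemLp H 2 (volume.restrict (Set.Ioc 0 σ)) :=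
      memLp_two_integral_divDiffDensity hh hξ x
    have hg : dslope (freqInt μ h ξ) x = bandInt σ H :=
      funext fun y => dslope_freqInt hσ.le hh hξ hs x y
    set S : ℝ := σ * ∫ v in (0 : ℝ)..σ, ‖H v‖ ^ 2
    have hS : ∀ t, HasSum (fun n => ‖bandInt σ H (t + sampleNode σ n)‖ ^ 2) S :=
      hasSum_norm_sq_bandInt hσ hH
    have hS0 : 0 ≤ S := (hS 0).nonneg fun _ => by positivity
    have hcont : Continuous (bandInt σ H) := continuous_bandInt hH hσ.le
    have hint : ENNReal.ofReal (2 * Real.pi / σ * S) ≤ ENNReal.ofReal (8 * σ * M ^ 2) := by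
      refine le_trans (le_of_eq ?_) (lintegral_enorm_sq_le hσ x (g := bandInt σ H)
        (fun y => hg ▸ norm_dslope_freqInt_le hσ hh hξ hs hM x y)
        (fun y => hg ▸ norm_dslope_mul_abs_le hM x y))
      have hT : 0 < 2 * Real.pi / σ := by positivity
      rw [lintegral_eq_setLIntegral_tsum hT (by fun_prop)]
      have : ∀ t : ℝ, ∑' n : ℤ, ‖bandInt σ H (t + n * (2 * Real.pi / σ))‖ₑ ^ 2 =
          ENNReal.ofReal S := by
        intro t
        rw [← (hS t).tsum_eq, ENNReal.ofReal_tsum_of_nonneg (fun _ => by positivity)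
          (hS t).summable]
        refine tsum_congr fun n => ?_
        rw [ENNReal.ofReal_pow (norm_nonneg _), ofReal_norm, sampleNode]
        congr 4
        ring
      simp_rw [this]
      rw [setLIntegral_const, Real.volume_Ioc, sub_zero, mul_comm, ENNReal.ofReal_mul hS0]
    rw [ENNReal.ofReal_le_ofReal_iff (by positivity)] at hint
    have hle := sum_le_hasSum s (fun _ _ => by positivity) (hS 0)
    simp only [zero_add] at hle
    rw [hg]
    refine hle.trans ?_
    rw [le_div_iff₀ Real.pi_pos]
    rw [div_mul_eq_mul_div, div_le_iff₀ hσ] at hint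
    nlinarith
  · simp only [dslope_freqInt hσ.le hh hξ hs]
    exact hasSum_bandInt hσ (memLp_two_integral_divDiffDensity hh hξ x) x'

/-- A quantity that decays away from `x` along the nodes decays like `1/(1 + |n|)`. -/
lemma le_div_one_add_abs {σ A B x a : ℝ} (hσ : 0 < σ) {n : ℤ} (ha : 0 ≤ a)
    (h1 : a ≤ A) (h2 : a * |sampleNode σ n - x| ≤ B) :
    a ≤ (A + (B + A * |x|) * σ / (2 * Real.pi)) / (1 + |(n : ℝ)|) := by
  rw [le_div_iff₀ (by positivity), mul_add, mul_one]
  refine add_le_add h1 ?_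
  rw [le_div_iff₀ (by positivity)]
  have h3 : |sampleNode σ n| ≤ |sampleNode σ n - x| + |x| := by
    simpa using abs_add_le (sampleNode σ n - x) x
  have h4 : |(n : ℝ)| * (2 * Real.pi) = |sampleNode σ n| * σ := by
    rw [sampleNode, abs_div, abs_mul, abs_of_pos hσ, abs_of_pos Real.two_pi_pos]
    field_simp
  rw [mul_assoc, h4, ← mul_assoc]
  refine mul_le_mul_of_nonneg_right ?_ hσ.le
  calc a * |sampleNode σ n| ≤ a * (|sampleNode σ n - x| + |x|) := by gcongr
    _ = a * |sampleNode σ n - x| + a * |x| := by ring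
    _ ≤ B + A * |x| := by gcongr

lemma norm_cardinalFun_le {σ : ℝ} (hσ : 0 < σ) (n : ℤ) (x : ℝ) : ‖cardinalFun σ n x‖ ≤ 1 := by
  have h := (le_hasSum (hasSum_norm_sq_cardinalFun hσ x) n fun _ _ => by positivity)
  exact (sq_le_one_iff₀ (norm_nonneg _)).1 h

lemma norm_cardinalFun_mul_le {σ : ℝ} (hσ : 0 < σ) (n : ℤ) (x : ℝ) :
    ‖cardinalFun σ n x‖ * |sampleNode σ n - x| ≤ 2 / σ := by
  set t := sampleNode σ n
  have h := integral_exp_mul_exp 0 (x - t) σ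
  have h' : ((x - t : ℝ) : ℂ) * (Complex.I * σ * cardinalFun σ n x) =
      Complex.exp ((x - t : ℝ) * σ * Complex.I) - 1 := by
    simp only [Complex.ofReal_zero, mul_zero, zero_mul, Complex.exp_zero, mul_one,
      sub_zero] at h
    rw [← h, cardinalFun, Complex.real_smul, Complex.ofReal_inv, mul_assoc Complex.I,
      mul_inv_cancel_left₀ (by exact_mod_cast hσ.ne'), intervalIntegral.integral_mul_const,
      Complex.ofReal_sub, mul_comm Complex.I]
  have h3 : |t - x| * (σ * ‖cardinalFun σ n x‖) ≤ 2 := by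
    have := congrArg norm h'
    rw [norm_mul, norm_mul, norm_mul, Complex.norm_I, one_mul, Complex.norm_real,
      Complex.norm_real, Real.norm_eq_abs, Real.norm_of_nonneg hσ.le, abs_sub_comm] at this
    rw [this]
    refine (norm_sub_le _ _).trans ?_
    rw [norm_exp_ofReal_mul_ofReal_mul_I, norm_one]
    norm_num
  rw [le_div_iff₀ hσ]
  linarith

lemma summable_one_div_one_add_abs_sq : Summable fun n : ℤ => 1 / (1 + |(n : ℝ)|) ^ 2 := by
  have : Summable fun n : ℕ => 1 / (1 + |((n : ℤ) : ℝ)|) ^ 2 := by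
    have h := (summable_nat_add_iff 1).2 (Real.summable_one_div_nat_pow.2 one_lt_two)
    refine h.congr fun n => ?_
    push_cast
    rw [Nat.abs_cast, add_comm]
  exact summable_int_iff_summable_nat_and_neg.2 ⟨this, by simpa using this⟩

/-- The property passes to limits for which the divided differences converge. -/
theorem HasCardinalDivDiff.of_tendsto {σ M : ℝ} (hσ : 0 < σ) {u : ℕ → ℝ → ℂ} {v : ℝ → ℂ}
    (hu : ∀ k, HasCardinalDivDiff σ M (u k))
    (hlim : ∀ x, Filter.Tendsto (fun k => u k x) Filter.atTop (nhds (v x)))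
    (hdlim : ∀ x x', Filter.Tendsto (fun k => dslope (u k) x x') Filter.atTop
      (nhds (dslope v x x'))) :
    HasCardinalDivDiff σ M v where
  norm_le x := le_of_tendsto' (hlim x).norm fun k => (hu k).norm_le x
  norm_dslope_le x x' := le_of_tendsto' (hdlim x x').norm fun k => (hu k).norm_dslope_le x x'
  sum_sq_le x s := le_of_tendsto' (tendsto_finsetSum s fun n _ => (hdlim x _).norm.pow 2)
    fun k => (hu k).sum_sq_le x s
  hasSum x x' := by
    -- Samples and cardinal functions are both `O(1/(1 + |n|))`, uniformly in `k`, so that the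
    -- series are dominated by a convergent one.
    set C₁ := σ * M + (2 * M + σ * M * |x|) * σ / (2 * Real.pi) with hC₁
    set C₂ := 1 + (2 / σ + 1 * |x'|) * σ / (2 * Real.pi) with hC₂
    have hM : 0 ≤ M := (norm_nonneg _).trans ((hu 0).norm_le 0)
    have hC₁0 : 0 ≤ C₁ := by positivity
    have hb : ∀ k n, ‖dslope (u k) x (sampleNode σ n) * cardinalFun σ n x'‖ ≤
        C₁ * C₂ * (1 / (1 + |(n : ℝ)|) ^ 2) := by
      intro k n
      have h1 := le_div_one_add_abs hσ (norm_nonneg _) ((hu k).norm_dslope_le x (sampleNode σ n))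
        (norm_dslope_mul_abs_le (hu k).norm_le x (sampleNode σ n))
      have h2 := le_div_one_add_abs hσ (norm_nonneg _) (norm_cardinalFun_le hσ n x')
        (norm_cardinalFun_mul_le hσ n x')
      rw [← hC₁] at h1
      rw [← hC₂] at h2
      rw [norm_mul]
      refine (mul_le_mul h1 h2 (norm_nonneg _) (by positivity)).trans (le_of_eq ?_)
      field_simp
    have hsum : Summable fun n : ℤ => C₁ * C₂ * (1 / (1 + |(n : ℝ)|) ^ 2) :=
      summable_one_div_one_add_abs_sq.mul_left _
    have hlim' : ∀ n, Filter.Tendsto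
        (fun k => dslope (u k) x (sampleNode σ n) * cardinalFun σ n x') Filter.atTop
        (nhds (dslope v x (sampleNode σ n) * cardinalFun σ n x')) :=
      fun n => (hdlim x _).mul_const _
    have ht := tendsto_tsum_of_dominated_convergence hsum hlim'
      (Filter.Eventually.of_forall fun k n => hb k n)
    simp_rw [fun k => ((hu k).hasSum x x').tsum_eq] at ht
    rw [tendsto_nhds_unique (hdlim x x') ht]
    exact (hsum.of_norm_bounded fun n =>
      le_of_tendsto' (hlim' n).norm fun k => hb k n).hasSum

/-! ### Superpositions of plane waves and spectra in the orthant -/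

/-- The Fourier transform of the bounded function `g` annihilates all Schwartz functions that
vanish on the closed orthant `[0, ∞)^d`. Requiring the functions to vanish only on the orthant, and
not near it, does not refer to supports and is stable under limits. -/
def HasOrthantSpectrum {d : ℕ} (g : EuclideanSpace ℝ (Fin d) → ℂ) : Prop :=
  ∀ u : 𝓢(EuclideanSpace ℝ (Fin d), ℂ), (∀ ζ, (∀ i, 0 ≤ ζ i) → u ζ = 0) →
    ∫ x, (𝓕 u) x * g x = 0

lemma isClosed_nonnegOrthant (d : ℕ) : IsClosed (nonnegOrthant d) := by
  rw [nonnegOrthant, Set.ofPred_forall]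
  exact isClosed_iInter fun i => isClosed_le continuous_const (by fun_prop)

lemma HasOrthantSpectrum.mem_contAnalytic {d : ℕ} {g : EuclideanSpace ℝ (Fin d) → ℂ}
    (hg : HasOrthantSpectrum g) (hc : Continuous g) {C : ℝ} (hC : ∀ x, ‖g x‖ ≤ C) :
    g ∈ contAnalytic d := by
  have hmem : MemLp g ∞ volume :=
    memLp_top_of_bound hc.aestronglyMeasurable C (Filter.Eventually.of_forall hC)
  refine ⟨hc, hmem, fun t ht => ?_⟩
  by_contra htn
  have hπ : 0 < (2 * Real.pi)⁻¹ := by positivity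
  have ht' : (2 * Real.pi)⁻¹ • t ∈ (nonnegOrthant d)ᶜ := by
    refine fun h => htn fun i => ?_
    have := h i
    rw [PiLp.smul_apply, smul_eq_mul] at this
    exact nonneg_of_mul_nonneg_right this hπ
  refine (Distribution.notMem_dsupport_iff _).2 ⟨(nonnegOrthant d)ᶜ, fun u hu => ?_,
    (isClosed_nonnegOrthant d).isOpen_compl, ht'⟩ ht
  rw [TemperedDistribution.fourier_apply, Lp.toTemperedDistribution_apply]
  rw [← hg u fun ζ hζ => image_eq_zero_of_notMem_tsupport fun h => hu h hζ]
  refine integral_congr_ae ?_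
  filter_upwards [hmem.coeFn_toLp] with x hx
  rw [hx, smul_eq_mul]

/-- Orthant spectrum is preserved by bounded pointwise convergence. -/
lemma HasOrthantSpectrum.of_tendsto {d : ℕ} {g : ℕ → EuclideanSpace ℝ (Fin d) → ℂ}
    {f : EuclideanSpace ℝ (Fin d) → ℂ} (hg : ∀ k, HasOrthantSpectrum (g k))
    (hm : ∀ k, Continuous (g k)) {C : ℝ} (hC : ∀ k x, ‖g k x‖ ≤ C)
    (hlim : ∀ x, Filter.Tendsto (fun k => g k x) Filter.atTop (nhds (f x))) :
    HasOrthantSpectrum f := by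
  intro u hu
  have h := tendsto_integral_of_dominated_convergence (F := fun k x => (𝓕 u) x * g k x)
    (f := fun x => (𝓕 u) x * f x) (μ := volume) (fun x => ‖(𝓕 u) x‖ * C)
    (fun k => ((𝓕 u).continuous.mul (hm k)).aestronglyMeasurable)
    ((𝓕 u).integrable.norm.mul_const C)
    (fun k => Filter.Eventually.of_forall fun x => by
      rw [norm_mul]
      exact mul_le_mul_of_nonneg_left (hC k x) (norm_nonneg _))
    (Filter.Eventually.of_forall fun x => (hlim x).const_mul _)
  simp_rw [hg _ u hu] at h
  exact (tendsto_nhds_unique h tendsto_const_nhds)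

/-- The function `q ↦ ∫ k(ω) e^{i(q, Ξ(ω))} dμ(ω)`: a superposition of plane waves with
frequency vectors `Ξ(ω)` and amplitudes `k(ω)`. -/
def waveInt {Ω : Type*} [MeasurableSpace Ω] {d : ℕ} (μ : Measure Ω) (k : Ω → ℂ)
    (Ξ : Ω → EuclideanSpace ℝ (Fin d)) (q : EuclideanSpace ℝ (Fin d)) : ℂ :=
  ∫ ω, k ω * Complex.exp ((inner ℝ q (Ξ ω) : ℝ) * Complex.I) ∂μ

section
variable {Ω : Type*} [MeasurableSpace Ω] {d : ℕ} {μ : Measure Ω} {k : Ω → ℂ}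
  {Ξ : Ω → EuclideanSpace ℝ (Fin d)}

lemma aestronglyMeasurable_wave (hk : Integrable k μ) (hΞ : Measurable Ξ)
    (q : EuclideanSpace ℝ (Fin d)) :
    AEStronglyMeasurable
      (fun ω => k ω * Complex.exp ((inner ℝ q (Ξ ω) : ℝ) * Complex.I)) μ :=
  hk.1.mul (by fun_prop)

lemma norm_wave {Ω : Type*} {k : Ω → ℂ} {Ξ : Ω → EuclideanSpace ℝ (Fin d)} (ω : Ω)
    (q : EuclideanSpace ℝ (Fin d)) :
    ‖k ω * Complex.exp ((inner ℝ q (Ξ ω) : ℝ) * Complex.I)‖ = ‖k ω‖ := by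
  rw [norm_mul, Complex.norm_exp_ofReal_mul_I, mul_one]

lemma norm_waveInt_le (hk : Integrable k μ) (q : EuclideanSpace ℝ (Fin d)) :
    ‖waveInt μ k Ξ q‖ ≤ ∫ ω, ‖k ω‖ ∂μ :=
  norm_integral_le_of_norm_le hk.norm (Filter.Eventually.of_forall fun ω => (norm_wave ω q).le)

lemma continuous_waveInt (hk : Integrable k μ) (hΞ : Measurable Ξ) :
    Continuous (waveInt μ k Ξ) :=
  continuous_of_dominated (aestronglyMeasurable_wave hk hΞ)
    (fun q => Filter.Eventually.of_forall fun ω => (norm_wave ω q).le) hk.norm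
    (Filter.Eventually.of_forall fun ω => by fun_prop)

/-- By Fourier inversion, pairing with `𝓕 u` integrates `u` over the frequencies. -/
lemma hasOrthantSpectrum_waveInt [SFinite μ] (hk : Integrable k μ) (hΞ : Measurable Ξ)
    (hpos : ∀ᵐ ω ∂μ, k ω ≠ 0 → ∀ i, 0 ≤ Ξ ω i) : HasOrthantSpectrum (waveInt μ k Ξ) := by
  intro u hu
  simp only [waveInt, ← integral_const_mul]
  rw [integral_integral_swap]
  · refine integral_eq_zero_of_ae ?_
    filter_upwards [hpos] with ω hω
    by_cases h0 : k ω = 0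
    · simp [h0]
    have hinv : (𝓕⁻ (𝓕 u)) ((2 * Real.pi)⁻¹ • Ξ ω) = 0 := by
      rw [FourierTransform.fourierInv_fourier_eq]
      refine hu _ fun i => ?_
      rw [PiLp.smul_apply, smul_eq_mul]
      exact mul_nonneg (by positivity) (hω h0 i)
    rw [SchwartzMap.fourierInv_coe, Real.fourierInv_eq'] at hinv
    have : ∀ x, (𝓕 u) x * (k ω * Complex.exp ((inner ℝ x (Ξ ω) : ℝ) * Complex.I)) =
        k ω * (Complex.exp (((2 * Real.pi * inner ℝ x ((2 * Real.pi)⁻¹ • Ξ ω) : ℝ)) * Complex.I) •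
          (𝓕 u) x) := by
      intro x
      rw [real_inner_smul_right, mul_inv_cancel_left₀ (by positivity), smul_eq_mul]
      ring
    simp only [this, integral_const_mul, hinv, mul_zero, Pi.zero_apply]
  · refine ((𝓕 u).integrable (μ := volume) |>.mul_prod hk).mono
      (AEStronglyMeasurable.mul
        ((𝓕 u).continuous.aestronglyMeasurable.comp_fst)
        (hk.1.comp_snd.mul (by fun_prop))) (Filter.Eventually.of_forall fun p => ?_)
    simp only [Function.uncurry]
    rw [norm_mul, norm_wave, norm_mul]

/-- The divided difference in the `i`-th coordinate of `G` at the points `q` and `q` with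
`i`-th coordinate replaced by `t`. -/
def coordDivDiff {d : ℕ} (G : EuclideanSpace ℝ (Fin d) → ℂ) (i : Fin d) (t : ℝ)
    (q : EuclideanSpace ℝ (Fin d)) : ℂ :=
  dslope (fun s : ℝ => G (q + (s - q i) • EuclideanSpace.single i 1)) (q i) t

lemma dslope_comm (u : ℝ → ℂ) (a b : ℝ) : dslope u a b = dslope u b a := by
  by_cases h : a = b
  · rw [h]
  · rw [dslope_of_ne _ h, dslope_of_ne _ (Ne.symm h), slope_comm]

/-- On a line parallel to the `i`-th axis, a superposition of plane waves is a superposition of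
exponentials with the `i`-th coordinates of the frequency vectors as frequencies. -/
lemma waveInt_slice (i : Fin d) (q : EuclideanSpace ℝ (Fin d)) (s : ℝ) :
    waveInt μ k Ξ (q + (s - q i) • EuclideanSpace.single i 1) =
      freqInt μ (fun ω => k ω * Complex.exp (((inner ℝ q (Ξ ω) - q i * Ξ ω i : ℝ) : ℂ) *
        Complex.I)) (fun ω => Ξ ω i) s := by
  unfold waveInt freqInt
  congr 1
  ext ω
  rw [inner_add_left, real_inner_smul_left, EuclideanSpace.inner_single_left, mul_assoc,
    ← Complex.exp_add]
  congr 2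
  push_cast
  simp
  ring

lemma integrable_slice (hk : Integrable k μ) (hΞ : Measurable Ξ) (i : Fin d)
    (q : EuclideanSpace ℝ (Fin d)) :
    Integrable (fun ω => k ω * Complex.exp (((inner ℝ q (Ξ ω) - q i * Ξ ω i : ℝ) : ℂ) *
        Complex.I)) μ := by
  refine hk.mono (hk.1.mul (by fun_prop)) (Filter.Eventually.of_forall fun ω => ?_)
  rw [norm_mul, Complex.norm_exp_ofReal_mul_I, mul_one]

/-- The divided difference of a superposition of plane waves, with one point of evaluation fixed,
is again a superposition of plane waves: the `i`-th frequency `Ξ(ω)ᵢ` is replaced by all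
frequencies between `0` and `Ξ(ω)ᵢ`. -/
lemma coordDivDiff_waveInt [SFinite μ] {σ : ℝ} (hσ : 0 ≤ σ) (hk : Integrable k μ)
    (hΞ : Measurable Ξ) (i : Fin d) (hs : ∀ ω, k ω ≠ 0 → Ξ ω i ∈ Set.Icc 0 σ) (t : ℝ)
    (q : EuclideanSpace ℝ (Fin d)) :
    coordDivDiff (waveInt μ k Ξ) i t q =
      waveInt (μ.prod (volume.restrict (Set.Ioc 0 σ)))
        (fun p => divDiffDensity k (fun ω => Ξ ω i) t p.1 p.2)
        (fun p => Ξ p.1 + (p.2 - Ξ p.1 i) • EuclideanSpace.single i 1) q := by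
  have hmeas : Measurable fun ω => Ξ ω i := by fun_prop
  unfold coordDivDiff
  rw [dslope_comm]
  simp only [waveInt_slice]
  rw [dslope_freqInt hσ (integrable_slice hk hΞ i q) hmeas
    (fun ω h => hs ω (left_ne_zero_of_mul h)), bandInt_divDiffDensity_eq_integral hσ
    (integrable_slice hk hΞ i q) hmeas]
  unfold waveInt
  rw [integral_prod]
  · congr 1
    ext ω
    rw [intervalIntegral.integral_of_le hσ]
    congr 1
    ext v
    have : Complex.exp ((inner ℝ q (Ξ ω + (v - Ξ ω i) • EuclideanSpace.single i 1) : ℝ) *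
        Complex.I) = Complex.exp (v * q i * Complex.I) *
          Complex.exp (((inner ℝ q (Ξ ω) - q i * Ξ ω i : ℝ) : ℂ) * Complex.I) := by
      rw [← Complex.exp_add, inner_add_right, real_inner_smul_right,
        EuclideanSpace.inner_single_right]
      congr 1
      push_cast
      simp
      ring
    rw [this]
    simp only [divDiffDensity]
    ring
  · have hd := integrable_divDiffDensity hk hmeas t (volume.restrict (Set.Ioc 0 σ))
    refine hd.mono (aestronglyMeasurable_wave hd (by fun_prop) q)
      (Filter.Eventually.of_forall fun p => ?_)
    rw [norm_mul, Complex.norm_exp_ofReal_mul_I, mul_one]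

lemma hasOrthantSpectrum_coordDivDiff_waveInt [SFinite μ] {σ : ℝ} (hσ : 0 ≤ σ)
    (hk : Integrable k μ) (hΞ : Measurable Ξ) (hs : ∀ ω, k ω ≠ 0 → ∀ i, Ξ ω i ∈ Set.Icc 0 σ)
    (i : Fin d) (t : ℝ) :
    Continuous (coordDivDiff (waveInt μ k Ξ) i t) ∧
      HasOrthantSpectrum (coordDivDiff (waveInt μ k Ξ) i t) := by
  have hd := integrable_divDiffDensity hk (ξ := fun ω => Ξ ω i) (by fun_prop) t
    (volume.restrict (Set.Ioc 0 σ))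
  have hm : Measurable fun p : Ω × ℝ =>
      Ξ p.1 + (p.2 - Ξ p.1 i) • EuclideanSpace.single i (1 : ℝ) := by fun_prop
  rw [funext fun q => coordDivDiff_waveInt hσ hk hΞ i (fun ω h => hs ω h i) t q]
  refine ⟨continuous_waveInt hd hm, hasOrthantSpectrum_waveInt hd hm ?_⟩
  have hae : ∀ᵐ v ∂volume.restrict (Set.Ioc 0 σ), 0 < v :=
    (ae_restrict_iff' measurableSet_Ioc).2 (Filter.Eventually.of_forall fun v hv => hv.1)
  filter_upwards [Measure.quasiMeasurePreserving_snd.ae hae] with p hp h0 j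
  have hk0 : k p.1 ≠ 0 := fun h => h0 (by simp [divDiffDensity, h])
  by_cases hj : j = i
  · subst hj
    simp [hp.le]
  · simpa [hj] using (hs p.1 hk0 j).1

lemma hasCardinalDivDiff_waveInt [SFinite μ] {σ M : ℝ} (hσ : 0 < σ)
    (hk : Integrable k μ) (hΞ : Measurable Ξ) (hs : ∀ ω, k ω ≠ 0 → ∀ i, Ξ ω i ∈ Set.Icc 0 σ)
    (hM : ∀ q, ‖waveInt μ k Ξ q‖ ≤ M) (i : Fin d) (q : EuclideanSpace ℝ (Fin d)) :
    HasCardinalDivDiff σ M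
      (fun s => waveInt μ k Ξ (q + (s - q i) • EuclideanSpace.single i 1)) := by
  have := fun s => hM (q + (s - q i) • EuclideanSpace.single i 1)
  simp only [waveInt_slice] at this ⊢
  exact hasCardinalDivDiff_freqInt hσ (integrable_slice hk hΞ i q) (by fun_prop)
    (fun ω h => hs ω (left_ne_zero_of_mul h) i) this

end

lemma cardinalFun_comp_mem_contAnalytic {σ : ℝ} (hσ : 0 < σ) {d : ℕ} (i : Fin d) (n : ℤ) :
    (fun q : EuclideanSpace ℝ (Fin d) => cardinalFun σ n (q i)) ∈ contAnalytic d := by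
  -- Their frequency vectors are the multiples `v eᵢ` with `0 < v ≤ σ`.
  set k : ℝ → ℂ := fun v => σ⁻¹ * Complex.exp ((-(v * sampleNode σ n) : ℝ) * Complex.I)
  set Ξ : ℝ → EuclideanSpace ℝ (Fin d) := fun v => v • EuclideanSpace.single i 1
  have hk : Integrable k (volume.restrict (Set.Ioc 0 σ)) :=
    (Continuous.integrableOn_Icc (by fun_prop)).mono_set Set.Ioc_subset_Icc_self
  have heq : (fun q : EuclideanSpace ℝ (Fin d) => cardinalFun σ n (q i)) =
      waveInt (volume.restrict (Set.Ioc 0 σ)) k Ξ := by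
    ext q
    rw [cardinalFun, waveInt, intervalIntegral.integral_of_le hσ.le, Complex.real_smul,
      ← integral_const_mul]
    congr 1
    ext v
    simp only [k, Ξ]
    rw [mul_assoc ((σ⁻¹ : ℝ) : ℂ), ← Complex.exp_add, real_inner_smul_right,
      EuclideanSpace.inner_single_right]
    push_cast
    congr 2
    simp
    ring
  have hm : Measurable Ξ := by fun_prop
  rw [heq]
  refine HasOrthantSpectrum.mem_contAnalytic (hasOrthantSpectrum_waveInt hk hm ?_)
    (continuous_waveInt hk hm) (norm_waveInt_le hk)
  refine (ae_restrict_iff' measurableSet_Ioc).2 (Filter.Eventually.of_forall fun v hv _ j => ?_)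
  by_cases hj : j = i
  · subst hj
    simpa [Ξ] using hv.1.le
  · simp [Ξ, hj]

/-! ### Supports of tempered distributions and Fourier inversion -/

open scoped Manifold ContDiff in
/-- A tempered distribution vanishes on the test functions with compact support off its support.
The definition of the support gives this only locally, and a partition of unity globalizes it. -/
theorem TemperedDistribution.apply_eq_zero_of_disjoint_dsupport {E : Type*} [NormedAddCommGroup E]
    [NormedSpace ℝ E] [FiniteDimensional ℝ E] (T : 𝓢'(E, ℂ)) (φ : 𝓢(E, ℂ))
    (hc : HasCompactSupport φ) (hd : Disjoint (tsupport φ) (Distribution.dsupport T)) :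
    T φ = 0 := by
  have hloc : ∀ x : tsupport φ, ∃ s : Set E, Distribution.IsVanishingOn T s ∧ IsOpen s ∧ ↑x ∈ s :=
    fun x => (Distribution.notMem_dsupport_iff _).1 (Set.disjoint_left.1 hd x.2)
  choose U hU hUo hxU using hloc
  obtain ⟨t, ht⟩ := hc.isCompact.elim_finite_subcover U hUo
    fun x hx => Set.mem_iUnion.2 ⟨⟨x, hx⟩, hxU _⟩
  obtain ⟨ρ, hρ⟩ := SmoothPartitionOfUnity.exists_isSubordinate 𝓘(ℝ, E) (isClosed_tsupport φ)
    (fun i : t => U i) (fun i => hUo i) (by simpa [Set.iUnion_subtype] using ht)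
  have hcs : ∀ i : t, HasCompactSupport (fun x => (ρ i x : ℂ) * φ x) := fun i => hc.mul_left
  have hsm : ∀ i : t, ContDiff ℝ ∞ (fun x => (ρ i x : ℂ) * φ x) := fun i =>
    (Complex.ofRealCLM.contDiff.comp (ρ i).contMDiff.contDiff).mul (φ.smooth _)
  have hsum : φ = ∑ i : t, (hcs i).toSchwartzMap (hsm i) := by
    ext x
    rw [sum_apply]
    change φ x = ∑ i : t, (ρ i x : ℂ) * φ x
    by_cases hx : x ∈ tsupport φ
    · have h1 := ρ.sum_eq_one hx
      rw [finsum_eq_sum_of_fintype] at h1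
      rw [← Finset.sum_mul, ← Complex.ofReal_sum, h1, Complex.ofReal_one, one_mul]
    · simp [image_eq_zero_of_notMem_tsupport hx]
  rw [hsum, map_sum]
  refine Finset.sum_eq_zero fun i _ => hU i _ ?_
  refine (closure_mono fun x hx => ?_).trans (hρ i)
  intro h0
  refine hx ?_
  change (ρ i x : ℂ) * φ x = 0
  rw [h0, Complex.ofReal_zero, zero_mul]

section
variable {V : Type*} [NormedAddCommGroup V] [InnerProductSpace ℝ V] [FiniteDimensional ℝ V]
  [MeasurableSpace V] [BorelSpace V]

lemma integral_fourier_mul_eq_flip {f g : V → ℂ} (hf : Integrable f) (hg : Integrable g) :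
    ∫ x, (𝓕 f) x * g x = ∫ x, f x * (𝓕 g) x := by
  have := VectorFourier.integral_fourierIntegral_smul_eq_flip (L := innerₗ V)
    Real.continuous_fourierChar continuous_inner hf hg
  rw [flip_innerₗ] at this
  exact this

open scoped ContDiff in
lemma exists_schwartzMap_eq_ofReal {E : Type*} [NormedAddCommGroup E] [NormedSpace ℝ E]
    {g : E → ℝ} (hg : ContDiff ℝ ∞ g) (hgc : HasCompactSupport g) :
    ∃ φ : 𝓢(E, ℂ), ∀ x, φ x = (g x : ℂ) := by
  have h1 : HasCompactSupport fun x => (g x : ℂ) := hgc.comp_left Complex.ofReal_zero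
  have h2 : ContDiff ℝ ∞ fun x => (g x : ℂ) := Complex.ofRealCLM.contDiff.comp hg
  exact ⟨h1.toSchwartzMap h2, fun x => rfl⟩

/-- Fourier inversion almost everywhere, for an integrable function with integrable transform. -/
theorem ae_eq_fourierInv_fourier {f : V → ℂ} (hf : Integrable f) (hF : Integrable (𝓕 f)) :
    f =ᵐ[volume] 𝓕⁻ (𝓕 f) := by
  have hcont : Continuous (𝓕⁻ (𝓕 f)) := by
    rw [Real.fourierInv_eq_fourier_comp_neg]
    exact VectorFourier.fourierIntegral_continuous Real.continuous_fourierChar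
      continuous_inner hF.comp_neg
  refine ae_eq_of_integral_contDiff_smul_eq hf.locallyIntegrable
    hcont.locallyIntegrable fun g hg hgc => ?_
  obtain ⟨φ, hφ⟩ := exists_schwartzMap_eq_ofReal hg hgc
  have e0 : ∀ x, (𝓕⁻ φ) x = (𝓕 φ) (-x) := fun x => by
    rw [SchwartzMap.fourierInv_coe, SchwartzMap.fourier_coe, Real.fourierInv_eq_fourier_neg]
  have e1 : ∫ x, g x • f x = ∫ x, f x * (𝓕 (𝓕⁻ φ)) x := by
    rw [FourierTransform.fourier_fourierInv_eq]
    refine integral_congr_ae (Filter.Eventually.of_forall fun x => ?_)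
    simp only [hφ, Complex.real_smul, mul_comm]
  have e2 : ∫ x, f x * (𝓕 (𝓕⁻ φ)) x = ∫ x, (𝓕 f) x * (𝓕⁻ φ) x :=
    (integral_fourier_mul_eq_flip hf (𝓕⁻ φ).integrable).symm
  have e3 : ∫ x, (𝓕 f) x * (𝓕⁻ φ) x = ∫ x, (𝓕 f) (-x) * (𝓕 φ) x := by
    rw [← integral_neg_eq_self]
    refine integral_congr_ae (Filter.Eventually.of_forall fun x => ?_)
    simp only [e0, neg_neg]
  have e4 : ∫ x, (𝓕 f) (-x) * (𝓕 φ) x = ∫ x, (𝓕 fun x => (𝓕 f) (-x)) x * φ x :=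
    (integral_fourier_mul_eq_flip hF.comp_neg φ.integrable).symm
  have e5 : ∫ x, (𝓕 fun x => (𝓕 f) (-x)) x * φ x = ∫ x, g x • (𝓕⁻ (𝓕 f)) x := by
    rw [Real.fourierInv_eq_fourier_comp_neg]
    refine integral_congr_ae (Filter.Eventually.of_forall fun x => ?_)
    simp only [hφ, Complex.real_smul, mul_comm]
  rw [e1, e2, e3, e4, e5]

lemma contDiff_fourierInv_of_hasCompactSupport {h : V → ℂ} (hc : Continuous h)
    (hs : HasCompactSupport h) : ContDiff ℝ (⊤ : ℕ∞) (𝓕⁻ h) := by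
  rw [Real.fourierInv_eq_fourier_comp_neg]
  refine Real.contDiff_fourier fun n _ => Continuous.integrable_of_hasCompactSupport
    (by fun_prop) ?_
  have : HasCompactSupport fun x => h (-x) := hs.comp_homeomorph (Homeomorph.neg V)
  exact this.norm.mul_left

end

/-! ### Localization of the spectrum by a product with a function of small spectrum -/

open scoped ContDiff in
/-- A smooth probability density on the unit cube `[0, 1]^d`. -/
lemma exists_smooth_density_unitCube (d : ℕ) : ∃ β : EuclideanSpace ℝ (Fin d) → ℝ,
    ContDiff ℝ ∞ β ∧ HasCompactSupport β ∧ (∀ ζ, 0 ≤ β ζ) ∧ ∫ ζ, β ζ = 1 ∧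
      ∀ ζ ∈ tsupport β, ∀ i, ζ i ∈ Set.Icc 0 1 := by
  set c : EuclideanSpace ℝ (Fin d) := WithLp.toLp 2 fun _ => 1 / 2
  let b : ContDiffBump c := ⟨1 / 4, 1 / 2, by norm_num, by norm_num⟩
  refine ⟨b.normed volume, b.contDiff_normed, b.hasCompactSupport_normed, b.nonneg_normed,
    b.integral_normed, fun ζ hζ i => ?_⟩
  rw [b.tsupport_normed_eq, Metric.mem_closedBall, dist_eq_norm] at hζ
  have h1 : |ζ i - 1 / 2| ≤ 1 / 2 := by
    have h2 : ‖(ζ - c) i‖ ≤ 1 / 2 := (PiLp.norm_apply_le (ζ - c) i).trans hζ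
    rwa [PiLp.sub_apply, Real.norm_eq_abs] at h2
  rw [abs_le] at h1
  constructor <;> linarith

section
variable {V : Type*} [NormedAddCommGroup V] [InnerProductSpace ℝ V] [FiniteDimensional ℝ V]
  [MeasurableSpace V] [BorelSpace V]

/-- The Fourier transform of a reflected, translated and dilated function, at `x`: it is a multiple
of the dilated inverse transform, with a character as a factor. -/
lemma fourier_comp_smul_sub (b : V → ℂ) {ε : ℝ} (hε : 0 < ε) (η x : V) :
    (𝓕 fun ξ => b (ε⁻¹ • (η - ξ))) x = (ε ^ Module.finrank ℝ V : ℝ) •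
      (Complex.exp ((-2 * Real.pi * inner ℝ x η : ℝ) * Complex.I) * (𝓕⁻ b) (ε • x)) := by
  rw [Real.fourier_eq', Real.fourierInv_eq']
  set g : V → ℂ := fun ζ =>
    Complex.exp ((-2 * Real.pi * inner ℝ (η - ε • ζ) x : ℝ) * Complex.I) • b ζ with hg
  have h1 : ∀ ξ, Complex.exp ((-2 * Real.pi * inner ℝ ξ x : ℝ) * Complex.I) •
      b (ε⁻¹ • (η - ξ)) = g (ε⁻¹ • (η - ξ)) := by
    intro ξ
    simp only [hg]
    rw [smul_inv_smul₀ hε.ne', sub_sub_cancel]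
  simp_rw [h1]
  rw [integral_sub_left_eq_self (fun y => g (ε⁻¹ • y)) volume η, Measure.integral_comp_smul,
    inv_pow, inv_inv, abs_of_pos (by positivity), ← integral_const_mul]
  congr 2
  ext ζ
  simp only [hg, smul_eq_mul]
  rw [← mul_assoc, ← Complex.exp_add]
  congr 2
  rw [inner_sub_left, real_inner_smul_left, real_inner_smul_right, real_inner_comm η x]
  push_cast
  ring

lemma fourierInv_ofReal_zero {β : V → ℝ} (h1 : ∫ ζ, β ζ = 1) :
    (𝓕⁻ fun ζ => (β ζ : ℂ)) 0 = 1 := by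
  rw [Real.fourierInv_eq']
  simp [integral_complex_ofReal, h1]

lemma norm_fourierInv_ofReal_le {β : V → ℝ} (h0 : ∀ ζ, 0 ≤ β ζ) (h1 : ∫ ζ, β ζ = 1) (x : V) :
    ‖(𝓕⁻ fun ζ => (β ζ : ℂ)) x‖ ≤ 1 := by
  rw [Real.fourierInv_eq', ← h1]
  refine (norm_integral_le_integral_norm _).trans (le_of_eq ?_)
  congr 1
  ext ζ
  rw [norm_smul, Complex.norm_exp_ofReal_mul_I, one_mul, Complex.norm_real,
    Real.norm_of_nonneg (h0 ζ)]

lemma ae_norm_le_Lp_top_norm (f : Lp ℂ ∞ (volume : Measure V)) :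
    ∀ᵐ x, ‖f x‖ ≤ ‖f‖ := by
  filter_upwards [ae_le_eLpNormEssSup (f := f) (μ := (volume : Measure V))] with x hx
  rw [← eLpNorm_exponent_top] at hx
  have := ENNReal.toReal_mono (Lp.eLpNorm_ne_top f) hx
  rwa [toReal_enorm, ← Lp.norm_def] at this

lemma integrable_Lp_top_mul_schwartz (f : Lp ℂ ∞ (volume : Measure V)) (φ : 𝓢(V, ℂ)) {ε : ℝ}
    (hε : ε ≠ 0) : Integrable fun x => f x * φ (ε • x) := by
  have h : Integrable fun x => φ (ε • x) := φ.integrable.comp_smul hε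
  exact h.bdd_mul (Lp.aestronglyMeasurable f) (ae_norm_le_Lp_top_norm f)

end

section
variable {d : ℕ} {σ ε : ℝ} {f : Lp ℂ ∞ (volume : Measure (EuclideanSpace ℝ (Fin d)))}

open scoped ContDiff in
/-- The product of `f` with a function whose frequencies are in the cube `[0, ε]^d` has its
frequencies in the cube `[0, σ/2π + ε]^d` (in the normalization of `𝓕`). -/
theorem fourier_mul_fourierInv_smul_eq_zero (hf : f ∈ expTypePlus d σ)
    {β : EuclideanSpace ℝ (Fin d) → ℝ} (hβ : ContDiff ℝ ∞ β) (hβc : HasCompactSupport β)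
    (hβs : ∀ ζ ∈ tsupport β, ∀ i, ζ i ∈ Set.Icc 0 1) (hε : 0 < ε)
    {η : EuclideanSpace ℝ (Fin d)} (hη : ¬ ∀ i, η i ∈ Set.Icc 0 (σ / (2 * Real.pi) + ε)) :
    (𝓕 fun x => f x * (𝓕⁻ fun ζ => (β ζ : ℂ)) (ε • x)) η = 0 := by
  -- The value at `η` is, up to a constant, the pairing of the distribution `𝓕 f` with the test
  -- function `ξ ↦ β ((η - ξ)/ε)`, whose support avoids that of `𝓕 f`.
  set A : EuclideanSpace ℝ (Fin d) → EuclideanSpace ℝ (Fin d) := fun ξ => ε⁻¹ • (η - ξ) with hA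
  have hAc : Continuous A := by fun_prop
  have hcs : HasCompactSupport (β ∘ A) := hβc.comp_homeomorph
    ((Homeomorph.subLeft η).trans (Homeomorph.smulOfNeZero ε⁻¹ (inv_ne_zero hε.ne')))
  have hsm : ContDiff ℝ ∞ (β ∘ A) := hβ.comp (by fun_prop)
  obtain ⟨Φ, hΦ⟩ := exists_schwartzMap_eq_ofReal hsm hcs
  have hΦ' : (Φ : EuclideanSpace ℝ (Fin d) → ℂ) = fun ξ => (β (ε⁻¹ • (η - ξ)) : ℂ) := funext hΦ
  have hts : tsupport Φ ⊆ tsupport (β ∘ A) := by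
    refine closure_mono fun ξ hξ h0 => hξ ?_
    rw [hΦ, h0, Complex.ofReal_zero]
  have hzero := TemperedDistribution.apply_eq_zero_of_disjoint_dsupport
    (𝓕 (f : 𝓢'(EuclideanSpace ℝ (Fin d), ℂ))) Φ
    (hcs.isCompact.of_isClosed_subset (isClosed_tsupport _) hts) ?_
  · rw [TemperedDistribution.fourier_apply, Lp.toTemperedDistribution_apply] at hzero
    have h1 : ∀ x, (𝓕 Φ) x • f x = (ε ^ Module.finrank ℝ (EuclideanSpace ℝ (Fin d)) : ℝ) •
        (Complex.exp ((-2 * Real.pi * inner ℝ x η : ℝ) * Complex.I) •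
          (f x * (𝓕⁻ fun ζ => (β ζ : ℂ)) (ε • x))) := by
      intro x
      rw [SchwartzMap.fourier_coe, hΦ', fourier_comp_smul_sub (fun ζ => (β ζ : ℂ)) hε]
      simp only [Complex.real_smul, smul_eq_mul]
      ring
    simp_rw [h1] at hzero
    rw [integral_smul, smul_eq_zero] at hzero
    rw [Real.fourier_eq']
    exact hzero.resolve_left (by positivity)
  · rw [Set.disjoint_left]
    intro ξ hξ hξ'
    have hmem : (2 * Real.pi) • ξ ∈ fourierSupport f := by
      rw [fourierSupport, Set.mem_ofPred_eq]
      rwa [inv_smul_smul₀ (by positivity)]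
    obtain ⟨hb, ho⟩ := hf hmem
    have hξA := hβs _ (tsupport_comp_subset_preimage β hAc (hts hξ))
    refine hη fun i => ?_
    have h2 := hξA i
    have h3 := ho i
    have h4 : ‖((2 * Real.pi) • ξ) i‖ ≤ σ :=
      (PiLp.norm_apply_le _ i).trans (mem_closedBall_zero_iff.1 hb)
    rw [Real.norm_eq_abs, abs_of_nonneg h3] at h4
    simp only [hA, PiLp.smul_apply, PiLp.sub_apply, smul_eq_mul, Set.mem_Icc] at h2 h3 h4
    have h5 : 0 ≤ ξ i := nonneg_of_mul_nonneg_right h3 (by positivity)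
    have h6 : ξ i ≤ σ / (2 * Real.pi) := by
      rw [le_div_iff₀ (by positivity)]
      linarith
    have h7 : 0 ≤ η i - ξ i := nonneg_of_mul_nonneg_right h2.1 (by positivity)
    have h8 : η i - ξ i ≤ ε := by
      have := h2.2
      rwa [inv_mul_le_iff₀ hε, mul_one] at this
    constructor <;> linarith

lemma hasCompactSupport_of_forall_mem_Icc {h : EuclideanSpace ℝ (Fin d) → ℂ} {a b : ℝ}
    (hh : ∀ η, (¬ ∀ i, η i ∈ Set.Icc a b) → h η = 0) : HasCompactSupport h := by
  have hK : IsCompact {η : EuclideanSpace ℝ (Fin d) | ∀ i, η i ∈ Set.Icc a b} := by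
    have := (PiLp.homeomorph 2 fun _ : Fin d => ℝ).isCompact_preimage.2
      (isCompact_univ_pi fun _ : Fin d => isCompact_Icc (a := a) (b := b))
    convert! this using 1
    ext η
    simp [PiLp.homeomorph, Pi.le_def, forall_and]
  exact HasCompactSupport.intro hK fun η hη => hh η hη

end

/-! ### The smooth representative -/

section
variable {V : Type*} [NormedAddCommGroup V] [InnerProductSpace ℝ V] [FiniteDimensional ℝ V]
  [MeasurableSpace V] [BorelSpace V]

open scoped ContDiff in
/-- Smooth representatives of a function on an exhausting sequence of balls fit together. -/
lemma exists_contDiff_ae_eq_of_balls {f : V → ℂ} {R : ℝ} (hR : 0 < R) {P : ℕ → V → ℂ}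
    (hP : ∀ n : ℕ, ContDiffOn ℝ ∞ (P n) (Metric.ball 0 (R * (n + 1))))
    (hae : ∀ n : ℕ, P n =ᵐ[volume.restrict (Metric.ball 0 (R * (n + 1)))] f) :
    ∃ F : V → ℂ, ContDiff ℝ ∞ F ∧ F =ᵐ[volume] f := by
  -- The value at `x` is taken from a ball that contains `x`; any other such ball gives the same.
  set N : V → ℕ := fun x => ⌊‖x‖ / R⌋₊
  set B : ℕ → Set V := fun n => Metric.ball 0 (R * (n + 1))
  have hB : ∀ n, IsOpen (B n) := fun n => Metric.isOpen_ball
  have hN : ∀ x, x ∈ B (N x) := fun x => by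
    rw [mem_ball_zero_iff, mul_comm, ← div_lt_iff₀ hR]
    exact Nat.lt_floor_add_one _
  have hagree : ∀ m n, Set.EqOn (P m) (P n) (B m ∩ B n) := fun m n => by
    refine Measure.eqOn_open_of_ae_eq (μ := volume) ?_ ((hB m).inter (hB n))
      ((hP m).continuousOn.mono Set.inter_subset_left)
      ((hP n).continuousOn.mono Set.inter_subset_right)
    filter_upwards [ae_restrict_of_ae_restrict_of_subset Set.inter_subset_left (hae m),
      ae_restrict_of_ae_restrict_of_subset Set.inter_subset_right (hae n)] with x h1 h2
    rw [h1, h2]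
  have hF : ∀ n, Set.EqOn (fun x => P (N x) x) (P n) (B n) :=
    fun n x hx => hagree (N x) n ⟨hN x, hx⟩
  refine ⟨fun x => P (N x) x, contDiff_iff_contDiffAt.2 fun x => ?_, ?_⟩
  · exact ((hP (N x)).contDiffAt ((hB _).mem_nhds (hN x))).congr_of_eventuallyEq
      ((hF (N x)).eventuallyEq_of_mem ((hB _).mem_nhds (hN x)))
  · have hU : ⋃ n, B n = Set.univ := Set.eq_univ_of_forall fun x => Set.mem_iUnion.2 ⟨_, hN x⟩
    rw [← Measure.restrict_univ (μ := volume), ← hU]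
    refine (ae_restrict_iUnion_iff _ _).2 fun n => ?_
    filter_upwards [hae n, ae_restrict_mem (hB n).measurableSet] with x hx hxB
    exact (hF n hxB).trans hx

lemma Continuous.norm_le_of_ae_norm_le {F : V → ℂ} (hF : Continuous F) {C : ℝ}
    (h : ∀ᵐ x, ‖F x‖ ≤ C) (x : V) : ‖F x‖ ≤ C := by
  by_contra hx
  have ho : IsOpen {x | ¬ ‖F x‖ ≤ C} := by
    simp only [not_le]
    exact isOpen_lt continuous_const hF.norm
  have := (ho.measure_eq_zero_iff volume).1 (ae_iff.1 h)
  exact Set.eq_empty_iff_forall_notMem.1 this x hx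

end

open scoped ContDiff in
/-- A bounded function with compact spectrum has a smooth representative, and its product with a
function of small spectrum is the inverse Fourier transform of an integrable function. -/
theorem exists_smooth_representative {d : ℕ} {σ : ℝ}
    {f : Lp ℂ ∞ (volume : Measure (EuclideanSpace ℝ (Fin d)))} (hf : f ∈ expTypePlus d σ)
    {β : EuclideanSpace ℝ (Fin d) → ℝ} (hβ : ContDiff ℝ ∞ β) (hβc : HasCompactSupport β)
    (hβ1 : ∫ ζ, β ζ = 1) (hβs : ∀ ζ ∈ tsupport β, ∀ i, ζ i ∈ Set.Icc 0 1) :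
    ∃ F : EuclideanSpace ℝ (Fin d) → ℂ, ContDiff ℝ ∞ F ∧ F =ᵐ[volume] f ∧
      (∀ x, ‖F x‖ ≤ ‖f‖) ∧ ∀ ε : ℝ, 0 < ε → ∃ h : EuclideanSpace ℝ (Fin d) → ℂ,
        Integrable h ∧ (∀ η, h η ≠ 0 → ∀ i, η i ∈ Set.Icc 0 (σ / (2 * Real.pi) + ε)) ∧
        ∀ x, F x * (𝓕⁻ fun ζ => (β ζ : ℂ)) (ε • x) = (𝓕⁻ h) x := by
  obtain ⟨b, hb⟩ := exists_schwartzMap_eq_ofReal hβ hβc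
  obtain ⟨θ, hθ⟩ : ∃ θ : 𝓢(EuclideanSpace ℝ (Fin d), ℂ), ∀ x,
      (𝓕⁻ fun ζ => (β ζ : ℂ)) x = θ x := by
    refine ⟨𝓕⁻ b, fun x => ?_⟩
    rw [SchwartzMap.fourierInv_coe, funext hb]
  have hθ0 : θ 0 = 1 := by rw [← hθ, fourierInv_ofReal_zero hβ1]
  set G : ℝ → EuclideanSpace ℝ (Fin d) → ℂ := fun ε x => f x * θ (ε • x) with hG
  have hGi : ∀ ε, 0 < ε → Integrable (G ε) := fun ε hε =>
    integrable_Lp_top_mul_schwartz f θ hε.ne'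
  have hh0 : ∀ ε, 0 < ε → ∀ η : EuclideanSpace ℝ (Fin d),
      (¬ ∀ i, η i ∈ Set.Icc 0 (σ / (2 * Real.pi) + ε)) → (𝓕 (G ε)) η = 0 := by
    intro ε hε η hη
    rw [← fourier_mul_fourierInv_smul_eq_zero hf hβ hβc hβs hε hη]
    simp only [hG, hθ]
  have hhc : ∀ ε, 0 < ε → Continuous (𝓕 (G ε)) := fun ε hε =>
    VectorFourier.fourierIntegral_continuous Real.continuous_fourierChar
      continuous_inner (hGi ε hε)
  have hhs : ∀ ε, 0 < ε → HasCompactSupport (𝓕 (G ε)) := fun ε hε =>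
    hasCompactSupport_of_forall_mem_Icc (hh0 ε hε)
  have hhi : ∀ ε, 0 < ε → Integrable (𝓕 (G ε)) := fun ε hε =>
    (hhc ε hε).integrable_of_hasCompactSupport (hhs ε hε)
  have hsm : ∀ ε, 0 < ε → ContDiff ℝ ∞ (𝓕⁻ (𝓕 (G ε))) := fun ε hε =>
    contDiff_fourierInv_of_hasCompactSupport (hhc ε hε) (hhs ε hε)
  have hae : ∀ ε, 0 < ε → G ε =ᵐ[volume] 𝓕⁻ (𝓕 (G ε)) := fun ε hε =>
    ae_eq_fourierInv_fourier (hGi ε hε) (hhi ε hε)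
  obtain ⟨r, hr, hrθ⟩ : ∃ r > 0, ∀ y, ‖y‖ < r → θ y ≠ 0 := by
    have := θ.continuous.continuousAt.eventually_ne (hθ0.trans_ne one_ne_zero)
    obtain ⟨r, hr, h⟩ := Metric.eventually_nhds_iff.1 this
    exact ⟨r, hr, fun y hy => h (by rwa [dist_zero_right])⟩
  have hrθ' : ∀ (n : ℕ) (x : EuclideanSpace ℝ (Fin d)), x ∈ Metric.ball 0 (r * (n + 1)) →
      θ (((n : ℝ) + 1)⁻¹ • x) ≠ 0 := by
    intro n x hx
    refine hrθ _ ?_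
    rw [norm_smul, norm_inv, Real.norm_of_nonneg (by positivity), inv_mul_lt_iff₀ (by positivity),
      mul_comm]
    exact mem_ball_zero_iff.1 hx
  -- On the ball of radius `r (n + 1)` the factor `θ(x/(n + 1))` has no zeros, and dividing by it
  -- recovers `f`.
  obtain ⟨F, hFs, hFf⟩ := exists_contDiff_ae_eq_of_balls (f := f) hr
    (P := fun n x => (𝓕⁻ (𝓕 (G ((n : ℝ) + 1)⁻¹))) x * (θ (((n : ℝ) + 1)⁻¹ • x))⁻¹)
    (fun n => (hsm _ (by positivity)).contDiffOn.mul
      (((θ.smooth _).comp (contDiff_const_smul _)).contDiffOn.inv (hrθ' n)))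
    (fun n => by
      filter_upwards [ae_restrict_of_ae (hae ((n : ℝ) + 1)⁻¹ (by positivity)),
        ae_restrict_mem Metric.isOpen_ball.measurableSet] with x hx hxB
      rw [← hx, hG, mul_inv_cancel_right₀ (hrθ' n x hxB)])
  refine ⟨F, hFs, hFf, ?_, fun ε hε => ⟨𝓕 (G ε), hhi ε hε, fun η h => ?_, fun x => ?_⟩⟩
  · refine hFs.continuous.norm_le_of_ae_norm_le ?_
    filter_upwards [hFf, ae_norm_le_Lp_top_norm f] with x hx hx'
    rwa [hx]
  · by_contra hn
    exact h (hh0 ε hε η hn)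
  · rw [hθ]
    refine congrFun (Measure.eq_of_ae_eq (μ := volume) (f := fun x => F x * θ (ε • x)) ?_
      (hFs.continuous.mul (θ.continuous.comp (continuous_const_smul ε)))
      (hsm ε hε).continuous) x
    filter_upwards [hFf, hae ε hε] with x hx hx'
    rw [← hx', hx]

/-! ### Approximation by superpositions of plane waves -/

section
variable {V : Type*} [NormedAddCommGroup V] [NormedSpace ℝ V]

/-- Divided differences along a line of the functions `x ↦ F(ax) θ(bx)` are continuous in the
parameters `a` and `b`. -/
lemma continuous_dslope_comp_smul_mul {F θ : V → ℂ} (hF : ContDiff ℝ 1 F) (hθ : ContDiff ℝ 1 θ)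
    (p e : V) (x x' : ℝ) : Continuous fun c : ℝ × ℝ =>
      dslope (fun s : ℝ => F (c.1 • (p + s • e)) * θ (c.2 • (p + s • e))) x x' := by
  have hF' := hF.continuous_fderiv one_ne_zero
  have hθ' := hθ.continuous_fderiv one_ne_zero
  have hFc := hF.continuous
  have hθc := hθ.continuous
  by_cases hx : x' = x
  · subst hx
    have hd : ∀ c : ℝ × ℝ, HasDerivAt
        (fun s : ℝ => F (c.1 • (p + s • e)) * θ (c.2 • (p + s • e)))
        (fderiv ℝ F (c.1 • (p + x' • e)) (c.1 • e) * θ (c.2 • (p + x' • e)) +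
          F (c.1 • (p + x' • e)) * fderiv ℝ θ (c.2 • (p + x' • e)) (c.2 • e)) x' := by
      intro c
      have hline : ∀ a : ℝ, HasDerivAt (fun s : ℝ => a • (p + s • e)) (a • e) x' := fun a => by
        have h := (((hasDerivAt_id x').smul_const e).const_add p).const_smul a
        rwa [one_smul] at h
      exact (((hF.differentiable one_ne_zero _).hasFDerivAt.comp_hasDerivAt x' (hline c.1))).mul
        ((hθ.differentiable one_ne_zero _).hasFDerivAt.comp_hasDerivAt x' (hline c.2))
    simp only [dslope_same, fun c => (hd c).deriv]
    fun_prop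
  · simp only [dslope_of_ne _ hx, slope_def_module]
    fun_prop

/-- A divided difference is the mean of the derivative. -/
lemma dslope_eq_integral_deriv {u u' : ℝ → ℂ} (hu : ∀ s, HasDerivAt u (u' s) s)
    (hc : Continuous u') (a b : ℝ) :
    dslope u a b = ∫ r in (0 : ℝ)..1, u' (a + r * (b - a)) := by
  by_cases h : b = a
  · subst h
    simp [(hu b).deriv]
  · rw [dslope_of_ne _ h, slope_def_module, inv_smul_eq_iff₀ (sub_ne_zero.2 h)]
    have := intervalIntegral.integral_unitInterval_deriv_eq_sub (f := u) (f' := u') (z₀ := a)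
      (z₁ := b - a) (by fun_prop) (fun t _ => hu _)
    rw [add_sub_cancel] at this
    simpa using this.symm

end

section
variable {d : ℕ}

lemma continuous_coordDivDiff {F : EuclideanSpace ℝ (Fin d) → ℂ} (hF : ContDiff ℝ 1 F) (i : Fin d)
    (t : ℝ) : Continuous (coordDivDiff F i t) := by
  have hF' := hF.continuous_fderiv one_ne_zero
  have h : ∀ q, coordDivDiff F i t q = ∫ r in (0 : ℝ)..1,
      fderiv ℝ F (q + (q i + r * (t - q i) - q i) • EuclideanSpace.single i 1)
        (EuclideanSpace.single i 1) := by
    intro q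
    refine dslope_eq_integral_deriv (u' := fun s => fderiv ℝ F
      (q + (s - q i) • EuclideanSpace.single i 1) (EuclideanSpace.single i 1)) (fun s => ?_)
      (by fun_prop) (q i) t
    have hline : HasDerivAt (fun s : ℝ => q + (s - q i) • EuclideanSpace.single i (1 : ℝ))
        (EuclideanSpace.single i 1) s := by
      simpa using (((hasDerivAt_id s).sub_const (q i)).smul_const
        (EuclideanSpace.single i (1 : ℝ))).const_add q
    exact (hF.differentiable one_ne_zero _).hasFDerivAt.comp_hasDerivAt s hline
  rw [funext h]
  refine intervalIntegral.continuous_parametric_intervalIntegral_of_continuous' ?_ 0 1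
  fun_prop

lemma fourierInv_smul_eq_waveInt (h : EuclideanSpace ℝ (Fin d) → ℂ) (a : ℝ)
    (y : EuclideanSpace ℝ (Fin d)) :
    (𝓕⁻ h) (a • y) = waveInt volume h (fun ξ => (2 * Real.pi * a) • ξ) y := by
  rw [Real.fourierInv_eq', waveInt]
  congr 1
  ext ξ
  rw [smul_eq_mul, mul_comm, real_inner_smul_right, real_inner_smul_right, real_inner_comm ξ y]
  congr 4
  ring

lemma slice_eq_line (i : Fin d) (q : EuclideanSpace ℝ (Fin d)) (s : ℝ) :
    q + (s - q i) • EuclideanSpace.single i (1 : ℝ) =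
      (q - q i • EuclideanSpace.single i 1) + s • EuclideanSpace.single i 1 := by
  rw [sub_smul]
  abel

/-- A function with spectrum in the part of the ball of radius `σ` in the orthant is a limit of
superpositions of plane waves with frequencies in `[0, σ]^d`, without increase of the norm.
The limit is taken for all divided differences. -/
theorem exists_smooth_representative_divDiff {σ : ℝ} (hσ : 0 < σ)
    {f : Lp ℂ ∞ (volume : Measure (EuclideanSpace ℝ (Fin d)))} (hf : f ∈ expTypePlus d σ) :
    ∃ F : EuclideanSpace ℝ (Fin d) → ℂ, ContDiff ℝ (⊤ : ℕ∞) F ∧ F =ᵐ[volume] f ∧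
      (∀ i t, coordDivDiff F i t ∈ contAnalytic d) ∧
      ∀ i q, HasCardinalDivDiff σ ‖f‖ (fun s => F (q + (s - q i) • EuclideanSpace.single i 1)) := by
  obtain ⟨β, hβ, hβc, hβ0, hβ1, hβs⟩ := exists_smooth_density_unitCube d
  obtain ⟨F, hF, hFf, hFb, hrep⟩ := exists_smooth_representative hf hβ hβc hβ1 hβs
  refine ⟨F, hF, hFf, ?_⟩
  have hF1 : ContDiff ℝ 1 F := hF.of_le (by exact_mod_cast le_top)
  set θ : EuclideanSpace ℝ (Fin d) → ℂ := 𝓕⁻ fun ζ => (β ζ : ℂ) with hθ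
  have hθ1 : ContDiff ℝ 1 θ := (contDiff_fourierInv_of_hasCompactSupport
    (Complex.continuous_ofReal.comp hβ.continuous) (hβc.comp_left Complex.ofReal_zero)).of_le
      (by exact_mod_cast le_top)
  have hθ0 : θ 0 = 1 := fourierInv_ofReal_zero hβ1
  have hθb : ∀ x, ‖θ x‖ ≤ 1 := norm_fourierInv_ofReal_le hβ0 hβ1
  set τ : ℝ := σ / (2 * Real.pi) with hτ
  have hτ0 : 0 < τ := by positivity
  have hτσ : 2 * Real.pi * τ = σ := by rw [hτ]; field_simp
  set ε : ℕ → ℝ := fun k => 1 / ((k : ℝ) + 1)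
  have hε0 : ∀ k, 0 < ε k := fun k => by positivity
  have hεlim : Filter.Tendsto ε Filter.atTop (nhds 0) := tendsto_one_div_add_atTop_nhds_zero_nat
  -- The dilation by `a` compensates for the widening of the spectrum by `ε`.
  set a : ℕ → ℝ := fun k => τ / (τ + ε k)
  have ha0 : ∀ k, 0 < a k := fun k => div_pos hτ0 (add_pos hτ0 (hε0 k))
  have halim : Filter.Tendsto a Filter.atTop (nhds 1) := by
    have : Filter.Tendsto a Filter.atTop (nhds (τ / (τ + 0))) :=
      tendsto_const_nhds.div (hεlim.const_add τ) (by simpa using hτ0.ne')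
    rwa [add_zero, div_self hτ0.ne'] at this
  have hclim : Filter.Tendsto (fun k => (a k, ε k * a k)) Filter.atTop (nhds ((1 : ℝ), (0 : ℝ))) :=
    halim.prodMk_nhds (by simpa using hεlim.mul halim)
  set Fk : ℕ → EuclideanSpace ℝ (Fin d) → ℂ :=
    fun k y => F (a k • y) * θ ((ε k * a k) • y) with hFk
  have hFkb : ∀ k y, ‖Fk k y‖ ≤ ‖f‖ := fun k y => by
    rw [hFk, norm_mul]
    exact (mul_le_of_le_one_right (norm_nonneg _) (hθb _)).trans (hFb _)
  have hwave : ∀ k, ∃ h : EuclideanSpace ℝ (Fin d) → ℂ, Integrable h ∧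
      (∀ ξ, h ξ ≠ 0 → ∀ i, ((2 * Real.pi * a k) • ξ) i ∈ Set.Icc 0 σ) ∧
      Fk k = waveInt volume h (fun ξ => (2 * Real.pi * a k) • ξ) := by
    intro k
    obtain ⟨h, hh, hs, hx⟩ := hrep (ε k) (hε0 k)
    refine ⟨h, hh, fun ξ hξ i => ?_, funext fun y => ?_⟩
    · obtain ⟨h1, h2⟩ := hs ξ hξ i
      have hak := ha0 k
      rw [PiLp.smul_apply, smul_eq_mul]
      refine ⟨by positivity, ?_⟩
      calc 2 * Real.pi * a k * ξ i ≤ 2 * Real.pi * a k * (τ + ε k) :=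
            mul_le_mul_of_nonneg_left h2 (by positivity)
        _ = 2 * Real.pi * (τ / (τ + ε k) * (τ + ε k)) := by ring
        _ = σ := by rw [div_mul_cancel₀ _ (add_pos hτ0 (hε0 k)).ne', hτσ]
    · rw [← fourierInv_smul_eq_waveInt, ← hx, smul_smul]
  have hdlim : ∀ i q x x', Filter.Tendsto
      (fun k => dslope (fun s => Fk k (q + (s - q i) • EuclideanSpace.single i 1)) x x')
      Filter.atTop
      (nhds (dslope (fun s => F (q + (s - q i) • EuclideanSpace.single i 1)) x x')) := by
    intro i q x x'
    have h := ((continuous_dslope_comp_smul_mul hF1 hθ1 (q - q i • EuclideanSpace.single i 1)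
      (EuclideanSpace.single i 1) x x').tendsto (1, 0)).comp hclim
    simp only [one_smul, zero_smul, hθ0, mul_one] at h
    simp only [slice_eq_line]
    exact h
  have hcard : ∀ k i q, HasCardinalDivDiff σ ‖f‖
      (fun s => Fk k (q + (s - q i) • EuclideanSpace.single i 1)) := by
    intro k i q
    obtain ⟨h, hh, hs, hx⟩ := hwave k
    have hb := hFkb k
    rw [hx] at hb ⊢
    exact hasCardinalDivDiff_waveInt hσ hh (by fun_prop) hs hb i q
  have hlim : ∀ y, Filter.Tendsto (fun k => Fk k y) Filter.atTop (nhds (F y)) := by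
    intro y
    have hc : Continuous fun c : ℝ × ℝ => F (c.1 • y) * θ (c.2 • y) := by
      have := hF1.continuous
      have := hθ1.continuous
      fun_prop
    have h := (hc.tendsto (1, 0)).comp hclim
    simp only [one_smul, zero_smul, hθ0, mul_one] at h
    exact h
  have hlimcard : ∀ i q, HasCardinalDivDiff σ ‖f‖
      (fun s => F (q + (s - q i) • EuclideanSpace.single i 1)) := fun i q =>
    HasCardinalDivDiff.of_tendsto hσ (fun k => hcard k i q) (fun x => hlim _) (hdlim i q)
  refine ⟨fun i t => ?_, hlimcard⟩
  refine HasOrthantSpectrum.mem_contAnalytic (HasOrthantSpectrum.of_tendsto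
    (g := fun k => coordDivDiff (Fk k) i t) (fun k => ?_) (fun k => ?_)
    (fun k q => (hcard k i q).norm_dslope_le _ _) (fun q => hdlim i q _ _))
    (continuous_coordDivDiff hF1 i t) (fun q => (hlimcard i q).norm_dslope_le _ _)
  all_goals
    obtain ⟨h, hh, hs, hx⟩ := hwave k
    rw [hx]
  · exact (hasOrthantSpectrum_coordDivDiff_waveInt hσ.le hh (by fun_prop) hs i t).2
  · exact (hasOrthantSpectrum_coordDivDiff_waveInt hσ.le hh (by fun_prop) hs i t).1
end

/-! ### Haagerup expansions of the divided differences -/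

section
variable {X Y : Type*} {A : Set (X → ℂ)} {B : Set (Y → ℂ)}

lemma rowNorm_le {φ : ℕ → X → ℂ} {c : ℝ}
    (h : ∀ x (s : Finset ℕ), ∑ n ∈ s, ‖φ n x‖ ^ 2 ≤ c) : rowNorm φ ≤ ENNReal.ofReal c := by
  refine iSup_le fun x => ?_
  rw [ENNReal.tsum_eq_iSup_sum]
  refine iSup_le fun s => ?_
  have : ∀ n, ‖φ n x‖ₑ ^ 2 = ENNReal.ofReal (‖φ n x‖ ^ 2) := fun n => by
    rw [ENNReal.ofReal_pow (norm_nonneg _), ofReal_norm]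
  simp_rw [this]
  rw [← ENNReal.ofReal_sum_of_nonneg fun n _ => by positivity]
  exact ENNReal.ofReal_le_ofReal (h x s)

lemma haagerupNorm_le {Φ : X → Y → ℂ} {φ : ℕ → X → ℂ} {ψ : ℕ → Y → ℂ}
    (h : IsHaagerupExpansion A B Φ φ ψ) {a b : ℝ} (ha : 0 ≤ a)
    (hφ : rowNorm φ ≤ ENNReal.ofReal (a ^ 2)) (hψ : rowNorm ψ ≤ ENNReal.ofReal (b ^ 2))
    (hb : 0 ≤ b) : haagerupNorm A B Φ ≤ ENNReal.ofReal (a * b) := by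
  have key : ∀ {r : ℝ≥0∞} {c : ℝ}, 0 ≤ c → r ≤ ENNReal.ofReal (c ^ 2) →
      r ^ (1 / 2 : ℝ) ≤ ENNReal.ofReal c := by
    intro r c hc hr
    refine (ENNReal.rpow_le_rpow hr (by norm_num)).trans (le_of_eq ?_)
    rw [ENNReal.ofReal_rpow_of_nonneg (by positivity) (by norm_num), ← Real.sqrt_eq_rpow,
      Real.sqrt_sq hc]
  rw [ENNReal.ofReal_mul ha]
  rw [haagerupNorm]
  exact iInf_le_of_le φ (iInf_le_of_le ψ (iInf_le_of_le h
    (mul_le_mul' (key ha hφ) (key hb hψ))))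

end

lemma sum_norm_sq_cardinalFun_le (e : ℕ ≃ ℤ) {σ : ℝ} (hσ : 0 < σ) (x : ℝ) (s : Finset ℕ) :
    ∑ n ∈ s, ‖cardinalFun σ (e n) x‖ ^ 2 ≤ 1 ^ 2 := by
  rw [one_pow]
  exact sum_le_hasSum s (fun _ _ => by positivity)
    (e.hasSum_iff (f := fun m => ‖cardinalFun σ m x‖ ^ 2) |>.2 (hasSum_norm_sq_cardinalFun hσ x))

lemma HasCardinalDivDiff.sum_norm_sq_dslope_le (e : ℕ ≃ ℤ) {σ M : ℝ} {u : ℝ → ℂ}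
    (hu : HasCardinalDivDiff σ M u) (x : ℝ) (s : Finset ℕ) :
    ∑ n ∈ s, ‖dslope u x (sampleNode σ (e n))‖ ^ 2 ≤
      (2 / √Real.pi * σ * M) ^ 2 := by
  have h := hu.sum_sq_le x (s.map e.toEmbedding)
  rw [Finset.sum_map] at h
  refine h.trans (le_of_eq ?_)
  rw [mul_pow, mul_pow, div_pow, Real.sq_sqrt Real.pi_pos.le]
  ring

lemma HasCardinalDivDiff.hasSum_nat (e : ℕ ≃ ℤ) {σ M : ℝ} {u : ℝ → ℂ}
    (hu : HasCardinalDivDiff σ M u) (x x' : ℝ) :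
    HasSum (fun n => dslope u x (sampleNode σ (e n)) * cardinalFun σ (e n) x')
      (dslope u x x') :=
  e.hasSum_iff (f := fun m => dslope u x (sampleNode σ m) * cardinalFun σ m x') |>.2
    (hu.hasSum x x')

lemma vec_eq_add_smul_single_zero (q : EuclideanSpace ℝ (Fin 2)) (s : ℝ) :
    !₂[s, q 1] = q + (s - q 0) • EuclideanSpace.single 0 1 := by
  ext j
  fin_cases j <;> simp

lemma vec_eq_add_smul_single_one (q : EuclideanSpace ℝ (Fin 2)) (s : ℝ) :
    !₂[q 0, s] = q + (s - q 1) • EuclideanSpace.single 1 1 := by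
  ext j
  fin_cases j <;> simp

end

/-- `f` is a class in `L^∞(ℝ²)`; `F` is its (unique) continuous representative, which is smooth. -/
theorem mainTheorem9 (σ : ℝ) (hσ : 0 < σ)
    (f : Lp ℂ ∞ (volume : Measure (EuclideanSpace ℝ (Fin 2)))) (hf : f ∈ expTypePlus 2 σ) :
    ∃ F : EuclideanSpace ℝ (Fin 2) → ℂ, ContDiff ℝ (⊤ : ℕ∞) F ∧ F =ᵐ[volume] f ∧
      divDiffX F ∈ haagerupTensor (contAnalytic 2) (contAnalytic 2) ∧
      divDiffY F ∈ haagerupTensor (contAnalytic 2) (contAnalytic 2) ∧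
      haagerupNorm (contAnalytic 2) (contAnalytic 2) (divDiffX F) ≤
        ENNReal.ofReal (2 / √Real.pi * σ * ‖f‖) ∧
      haagerupNorm (contAnalytic 2) (contAnalytic 2) (divDiffY F) ≤
        ENNReal.ofReal (2 / √Real.pi * σ * ‖f‖) := by
  obtain ⟨F, hF, hFf, hmem, hcard⟩ := exists_smooth_representative_divDiff hσ hf
  -- An enumeration of the sampling nodes by the natural numbers.
  obtain ⟨e⟩ : Nonempty (ℕ ≃ ℤ) := ⟨Equiv.intEquivNat.symm⟩
  have hC : 0 ≤ 2 / √Real.pi * σ * ‖f‖ := by positivity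
  have hcardMem : ∀ (i : Fin 2) (n : ℕ), (fun q : EuclideanSpace ℝ (Fin 2) =>
      cardinalFun σ (e n) (q i)) ∈ contAnalytic 2 :=
    fun i n => cardinalFun_comp_mem_contAnalytic hσ i _
  have hrowCard : ∀ i : Fin 2, rowNorm (fun (n : ℕ) (q : EuclideanSpace ℝ (Fin 2)) =>
      cardinalFun σ (e n) (q i)) ≤ ENNReal.ofReal (1 ^ 2) :=
    fun i => rowNorm_le fun q s => sum_norm_sq_cardinalFun_le e hσ (q i) s
  have hrowDiff : ∀ i : Fin 2, rowNorm (fun n : ℕ =>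
      coordDivDiff F i (sampleNode σ (e n))) ≤
        ENNReal.ofReal ((2 / √Real.pi * σ * ‖f‖) ^ 2) :=
    fun i => rowNorm_le fun q s => (hcard i q).sum_norm_sq_dslope_le e (q i) s
  have hX : IsHaagerupExpansion (contAnalytic 2) (contAnalytic 2) (divDiffX F)
      (fun n p => cardinalFun σ (e n) (p 0))
      (fun n => coordDivDiff F 0 (sampleNode σ (e n))) :=
    { left_mem := hcardMem 0
      right_mem := fun n => hmem 0 _
      left_bounded := (hrowCard 0).trans_lt ENNReal.ofReal_lt_top
      right_bounded := (hrowDiff 0).trans_lt ENNReal.ofReal_lt_top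
      hasSum := fun p q => by
        simp only [divDiffX, vec_eq_add_smul_single_zero, mul_comm (cardinalFun _ _ _)]
        exact (hcard 0 q).hasSum_nat e (q 0) (p 0) }
  -- The divided difference in `y` is symmetric in `y₁` and `y₂`, so the roles of the two factors
  -- can be exchanged.
  have hY : IsHaagerupExpansion (contAnalytic 2) (contAnalytic 2) (divDiffY F)
      (fun n => coordDivDiff F 1 (sampleNode σ (e n)))
      (fun n q => cardinalFun σ (e n) (q 1)) :=
    { left_mem := fun n => hmem 1 _
      right_mem := hcardMem 1
      left_bounded := (hrowDiff 1).trans_lt ENNReal.ofReal_lt_top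
      right_bounded := (hrowCard 1).trans_lt ENNReal.ofReal_lt_top
      hasSum := fun p q => by
        simp only [divDiffY, vec_eq_add_smul_single_one, dslope_comm _ (q 1)]
        exact (hcard 1 p).hasSum_nat e (p 1) (q 1) }
  refine ⟨F, hF, hFf, ⟨_, _, hX⟩, ⟨_, _, hY⟩, ?_, ?_⟩
  · simpa only [one_mul] using haagerupNorm_le hX zero_le_one (hrowCard 0) (hrowDiff 0) hC
  · simpa only [mul_one] using haagerupNorm_le hY hC (hrowDiff 1) (hrowCard 1) zero_le_one
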